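/- Consider the totally asymmetric simple exclusion process of $N\ge 1$ particles on $\mathbb Z$ in continuous time: each particle hops one site to the right at rate $1$, and a hop is suppressed when the target site is occupied. The particles are labelled $1,\dots,N$ from the left and start at time $0$ from arbitrary integer sites $y_1<y_2<\cdots<y_N$; let $x_1$ be the position of the leftmost particle at time $t$. For an integer $n\le 0$, $m\in\mathbb C$ with $\operatorname{Re} m>-1$, and $s\ge 0$ put \[ F_n(m;s)=e^{-s}\,\frac{s^m}{m!}\sum_{k=0}^{\infty}\frac{(n)_k}{(m+1)_k}\frac{s^k}{k!},\qquad (a)_k=a(a+1)\cdots(a+k-1),\quad m!=\Gamma(m+1), \] and for $M\in\mathbb C$ with $\operatorname{Re}M>y_N-y_1$ put \[ I(M)=\frac{1}{\prod_{j=1}^N j!}\int_{[0,t]^N}\ \prod_{1\le j<k\le N}(t_k-t_j)\ \det\bigl[F_{-j+1}(y_1-y_j+M-1;\,t_{N-k+1})\bigr]_{j,k=1}^N\,dt_1\cdots dt_N . \] 1. For every $t\ge 0$ and every complex $M$ with $\operatorname{Re}M>y_N-y_1$ the integral converges absolutely, and for every integer $M>y_N-y_1$ the probability that the leftmost particle has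 hopped at least $M$ steps by time $t$ is \[ \mathbb P[x_1\ge y_1+M]=I(M). \] 2. For every $t>0$ the function $I$ extends to an entire function of $M$, and at every integer $M$ (in particular for $M\le y_N-y_1$) the value of this analytic continuation is $\mathbb P[x_1\ge y_1+M]$. 3. For the step initial condition $y_j=-N+j$ $(1\le j\le N)$, every $t\ge 0$ and every integer $M\ge N$, the integral reduces to Johansson's Laguerre unitary ensemble formula \[ I(M)=\frac{1}{Z_{M,N}}\int_{[0,t]^N}\ \prod_{1\le j<k\le N}(t_k-t_j)^2\ \prod_{j=1}^N t_j^{M-N}e^{-t_j}\,dt_1\cdots dt_N,\qquad Z_{M,N}=\prod_{j=1}^N j!\,(M-N+j-1)!. \] -/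

import Mathlib

open MeasureTheory ProbabilityTheory Filter Topology
open scoped NNReal Nat

noncomputable section

/-- Generator of the totally asymmetric simple exclusion process of `N` labelled particles on `ℤ`:
each particle tries to hop one site to the right at rate one, and the hop is carried out exactly
when the target site is empty. A configuration `x` lists the positions of the particles. -/
def tasepGenerator {N : ℕ} (f : (Fin N → ℤ) → ℝ) (x : Fin N → ℤ) : ℝ :=
  ∑ j : Fin N,
    if ∀ k : Fin N, x k ≠ x j + 1 then f (Function.update x j (x j + 1)) - f x else 0

/-- `X` is a totally asymmetric simple exclusion process started from the configuration `y`: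
a càdlàg process, adapted to the filtration `ℱ`, which solves the martingale problem for the
(bounded) generator. The state space `Fin N → ℤ` is discrete. -/
structure IsTASEP {Ω : Type*} {mΩ : MeasurableSpace Ω} {N : ℕ} (μ : Measure Ω)
    (ℱ : Filtration ℝ≥0 mΩ) (y : Fin N → ℤ) (X : ℝ≥0 → Ω → Fin N → ℤ) : Prop where
  initial : ∀ᵐ ω ∂μ, X 0 ω = y
  right_continuous : ∀ ω t, ContinuousWithinAt (fun s => X s ω) (Set.Ici t) t
  left_limits : ∀ ω t, ∃ x, Tendsto (fun s => X s ω) (𝓝[<] t) (𝓝 x)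
  adapted : Adapted ℱ X
  martingale : ∀ f : (Fin N → ℤ) → ℝ, (∃ C, ∀ x, |f x| ≤ C) →
    Martingale
      (fun t ω => f (X t ω) - ∫ s in (0 : ℝ)..t, tasepGenerator f (X s.toNNReal ω)) ℱ μ

/-- `F_n(m;t) = e^{-t} (t^m / m!) ∑_k (n)_k / (m+1)_k * t^k / k!`, with `m! = Γ(m+1)` so that
`m` may be complex; `(n)_k` is the rising factorial. -/
def greenF (n : ℤ) (m : ℂ) (t : ℝ) : ℂ :=
  Complex.exp (-(t : ℂ)) * ((t : ℂ) ^ m / Complex.Gamma (m + 1)) *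
    ∑' k : ℕ, (ascPochhammer ℂ k).eval (n : ℂ) / (ascPochhammer ℂ k).eval (m + 1) *
      ((t : ℂ) ^ k / (k ! : ℂ))

/-- The integrand `∏_{j<k} (t_k - t_j) * det[F_{-j+1}(y_1 - y_j + M - 1; t_{N-k+1})]`, as a function
of `(t_1, …, t_N)` and of a complex `M`. Indices in `Fin N` start from zero, so that the suffix
`-j+1` becomes `-j`, and `t_{N-k+1}` becomes `t (Fin.rev k)`. -/
def hopIntegrand {N : ℕ} [NeZero N] (y : Fin N → ℤ) (M : ℂ) (t : Fin N → ℝ) : ℂ :=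
  (∏ j : Fin N, ∏ k ∈ Finset.Ioi j, ((t k : ℂ) - (t j : ℂ))) *
    (Matrix.of fun j k : Fin N =>
      greenF (-(j : ℤ)) ((y 0 : ℂ) - (y j : ℂ) + M - 1) (t (Fin.rev k))).det

/-- `(1 / ∏_{j=1}^N j!) ∫_{[0,T]^N} ∏_{j<k} (t_k - t_j) det[…] dt`. -/
def hopIntegral {N : ℕ} [NeZero N] (y : Fin N → ℤ) (T : ℝ) (M : ℂ) : ℂ :=
  1 / (∏ j : Fin N, (((j : ℕ) + 1)! : ℂ)) *
    ∫ t in Set.Icc (0 : Fin N → ℝ) (fun _ => T), hopIntegrand y M t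

/-- Johansson's Laguerre unitary ensemble integral
`(1 / Z_{M,N}) ∫_{[0,T]^N} ∏_{j<k} (t_k - t_j)² ∏_j t_j^{M-N} e^{-t_j} dt`, with
`Z_{M,N} = ∏_{j=1}^N j! (M-N+j-1)!`; it is meant for `N ≤ M`. -/
def laguerreIntegral (N M : ℕ) (T : ℝ) : ℝ :=
  1 / (∏ j : Fin N, (((j : ℕ) + 1)! : ℝ) * ((M - N + (j : ℕ))! : ℝ)) *
    ∫ t in Set.Icc (0 : Fin N → ℝ) (fun _ => T),
      (∏ j : Fin N, ∏ k ∈ Finset.Ioi j, (t k - t j) ^ 2) *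
        ∏ j : Fin N, (t j ^ (M - N) * Real.exp (-(t j)))

end

/-! Both the integral and the probability are identified with one determinant, whose `(j, i)` entry
is the `j`-fold difference in the index of the `(i+1)`-fold tail sum of the Poisson weights
(`tailEntry`).

For the integral: `greenF (-j)` is the `j`-fold difference of the Poisson weight
(`greenF_neg_natCast`). The Vandermonde product is also a Vandermonde determinant in the variables
`T - t_k`, so Andréief's identity (`integral_det_mul_det`) reduces the `N`-fold integral to a
determinant of single integrals against `(T - s)^i`. That power is Cauchy's kernel for repeated
integration, and repeated time integration of a Poisson weight produces its repeated tail sums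
(`integral_sub_pow_mul_greenF`, `hopIntegral_eq_det`). For `T > 0` the tail sums are entire in the
index, because `1/Γ` is entire and decays factorially along `z, z + 1, …`; hence so is the
determinant.

For the probability: the time derivative of row `j` is row `j + 1` at the same shifted argument, and
also the change of row `j` under a free hop. By multilinearity the determinant obeys the backward
equation: a free hop gives a difference of determinants, a blocked hop gives two equal rows and
contributes zero (`det_updateRow_sitesToGo`). Replacing negative arguments by zero leaves the
determinant unchanged (`det_hopMatrix_max_zero`) and makes it bounded over all ordered
configurations. At time zero it is the indicator of the event (`det_hopMatrix_zero_right`). A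
bounded solution and the expectation under the martingale problem both agree with the exponential
series of the bounded generator, so they coincide (`IsTASEP.integral_eq_of_backward`).

For step initial data the matrix of `greenF` is a unipotent matrix times a matrix of Poisson
weights, whose determinant supplies the second Vandermonde factor (`hopIntegrand_step`). -/

noncomputable section

/-! ### Poisson weights with complex index and their iterated tail sums -/

/-- The Poisson weight `e^{-t} t^z / Γ(z+1)` with a complex index `z`. -/
def poissonWeight (z : ℂ) (t : ℝ) : ℂ :=
  Complex.exp (-(t : ℂ)) * ((t : ℂ) ^ z / Complex.Gamma (z + 1))

/-- The `(i+1)`-fold tail sum of the Poisson weights. -/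
def poissonTail (i : ℕ) (m : ℂ) (t : ℝ) : ℂ :=
  ∑' l : ℕ, ((l + i).choose i : ℂ) * poissonWeight (m + i + l) t

/-- After a shift by `L ≥ ρ + 1` one has `‖z + L + l‖ ≥ l + 1`, so the functional equation yields
decay like `1 / l!`. Undoing the shift costs the factor `(|ρ| + l + L) ^ L`, which is absorbed into
an exponential of `l`; hence `A = e`. -/
lemma Complex.norm_inv_Gamma_add_natCast_le (ρ : ℝ) :
    ∃ C A : ℝ, 0 ≤ C ∧ 0 ≤ A ∧ ∀ z : ℂ, ‖z‖ ≤ ρ → ∀ l : ℕ,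
      ‖(Complex.Gamma (z + l))⁻¹‖ ≤ C * (A ^ l / (l ! : ℝ)) := by
  obtain ⟨L, hL⟩ := exists_nat_ge (ρ + 1)
  obtain ⟨B, hB⟩ := (isCompact_closedBall (0 : ℂ) ρ).exists_bound_of_continuousOn
    (f := fun z : ℂ => (Complex.Gamma (z + L))⁻¹)
    ((Complex.differentiable_one_div_Gamma.continuous.comp
      (continuous_id.add continuous_const)).continuousOn)
  have hup : ∀ z : ℂ, ‖z‖ ≤ ρ → ∀ l : ℕ,
      ‖(Complex.Gamma (z + L + l))⁻¹‖ ≤ B / (l ! : ℝ) := by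
    intro z hz l
    induction l with
    | zero => simpa using hB z (by simpa using hz)
    | succ l ih =>
      have hnorm : (l + 1 : ℝ) ≤ ‖z + L + l‖ := by
        have h1 : ‖(L + l : ℂ)‖ - ‖-z‖ ≤ ‖(L + l : ℂ) - (-z)‖ := norm_sub_norm_le _ _
        have h2 : ‖(L + l : ℂ)‖ = L + l := by
          rw [← Nat.cast_add, Complex.norm_natCast]; push_cast; rfl
        rw [h2, norm_neg] at h1
        have h3 : (L + l : ℂ) - (-z) = z + L + l := by ring
        rw [h3] at h1
        linarith
      have hpos : (0 : ℝ) < l + 1 := by positivity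
      have hne : z + L + l ≠ 0 := by
        intro h0; rw [h0, norm_zero] at hnorm; linarith
      have : z + L + ((l + 1 : ℕ) : ℂ) = z + L + l + 1 := by push_cast; ring
      rw [this, Complex.Gamma_add_one _ hne, mul_inv, norm_mul, norm_inv, Nat.factorial_succ]
      have hB0 : 0 ≤ B / (l ! : ℝ) := (norm_nonneg _).trans ih
      calc ‖z + L + l‖⁻¹ * ‖(Complex.Gamma (z + L + l))⁻¹‖
          ≤ (l + 1 : ℝ)⁻¹ * (B / (l ! : ℝ)) := by gcongr
        _ = B / (((l + 1) * l ! : ℕ) : ℝ) := by push_cast; field_simp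
  have hdown : ∀ n : ℕ, ∀ z : ℂ, ∀ l : ℕ, ‖z‖ ≤ ρ → n ≤ L →
      ‖(Complex.Gamma (z + l))⁻¹‖ ≤ (|ρ| + l + L) ^ n * ‖(Complex.Gamma (z + n + l))⁻¹‖ := by
    intro n z l hz
    induction n with
    | zero => intro _; simp
    | succ n ih =>
      intro hn
      refine (ih (by omega)).trans ?_
      rw [Complex.one_div_Gamma_eq_self_mul_one_div_Gamma_add_one (z + n + l), norm_mul, pow_succ,
        mul_assoc]
      have h1 : ‖z + n + l‖ ≤ |ρ| + l + L := by
        calc ‖z + n + l‖ ≤ ‖z‖ + ‖(n : ℂ)‖ + ‖(l : ℂ)‖ := norm_add₃_le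
          _ ≤ |ρ| + L + l := by
            rw [Complex.norm_natCast, Complex.norm_natCast]
            have : (n : ℝ) ≤ L := by exact_mod_cast (by omega : n ≤ L)
            linarith [le_abs_self ρ]
          _ = _ := by ring
      have h2 : z + n + l + 1 = z + ((n + 1 : ℕ) : ℂ) + l := by push_cast; ring
      rw [h2]
      gcongr
  have hB0 : 0 ≤ |B| := abs_nonneg B
  refine ⟨(L ! : ℝ) * Real.exp (|ρ| + L) * |B|, Real.exp 1, by positivity, by positivity, ?_⟩
  intro z hz l
  have h1 := hdown L z l hz le_rfl
  have h2 := hup z hz l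
  have h3 : (|ρ| + l + L) ^ L ≤ (L ! : ℝ) * Real.exp (|ρ| + l + L) := by
    have := Real.pow_div_factorial_le_exp (x := |ρ| + l + L) (by positivity) L
    rw [div_le_iff₀ (by positivity)] at this
    linarith
  have h4 : Real.exp (|ρ| + l + L) = Real.exp (|ρ| + L) * Real.exp 1 ^ l := by
    rw [← Real.exp_nat_mul, ← Real.exp_add]; ring_nf
  calc ‖(Complex.Gamma (z + l))⁻¹‖
      ≤ (|ρ| + l + L) ^ L * ‖(Complex.Gamma (z + L + l))⁻¹‖ := h1
    _ ≤ ((L ! : ℝ) * Real.exp (|ρ| + l + L)) * (|B| / (l ! : ℝ)) := by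
        gcongr
        exact h2.trans (by gcongr; exact le_abs_self B)
    _ = _ := by rw [h4]; ring

/-- A bound for the series of iterated Poisson tails, uniform for `z` in a bounded set. -/
lemma exists_summable_bound_choose_mul_inv_Gamma (i : ℕ) (ρ R : ℝ) (hR : 0 ≤ R) :
    ∃ u : ℕ → ℝ, Summable u ∧ ∀ z : ℂ, ‖z‖ ≤ ρ → ∀ l : ℕ,
      ((l + i).choose i : ℝ) * R ^ l * ‖(Complex.Gamma (z + l + 1))⁻¹‖ ≤ u l := by
  obtain ⟨C, A, hC, hA, h⟩ := Complex.norm_inv_Gamma_add_natCast_le (ρ + 1)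
  refine ⟨fun l => 2 ^ i * C * ((2 * R * A) ^ l / (l ! : ℝ)),
    (Real.summable_pow_div_factorial _).mul_left _, fun z hz l => ?_⟩
  have h1 : ((l + i).choose i : ℝ) ≤ 2 ^ (l + i) := by
    exact_mod_cast Nat.choose_le_two_pow (l + i) i
  have h2 := h (z + 1) ((norm_add_le _ _).trans (by simpa using hz)) l
  rw [show z + 1 + l = z + l + 1 by ring] at h2
  calc _ ≤ 2 ^ (l + i) * R ^ l * (C * (A ^ l / (l ! : ℝ))) := by gcongr
    _ = 2 ^ i * C * ((2 * R * A) ^ l / (l ! : ℝ)) := by rw [mul_pow, mul_pow, pow_add]; ring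

lemma norm_poissonWeight_add {t : ℝ} (ht : 0 < t) (z : ℂ) (l : ℕ) :
    ‖poissonWeight (z + l) t‖ =
      Real.exp (-t) * t ^ z.re * (t ^ l * ‖(Complex.Gamma (z + l + 1))⁻¹‖) := by
  have h0 : (t : ℂ) ≠ 0 := by exact_mod_cast ht.ne'
  rw [poissonWeight, Complex.cpow_add _ _ h0, Complex.cpow_natCast, norm_mul, norm_div, norm_mul,
    Complex.norm_cpow_eq_rpow_re_of_pos ht, norm_pow, Complex.norm_real, Real.norm_of_nonneg ht.le,
    norm_inv, ← Complex.ofReal_neg, Complex.norm_exp_ofReal]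
  ring

/-- Uniformity in both variables lets the same majorant justify termwise differentiation in the
index and in time. -/
lemma exists_summable_bound_poissonTail (i : ℕ) (ρ : ℝ) {r R : ℝ} (hr : 0 < r) (hrR : r ≤ R) :
    ∃ u : ℕ → ℝ, Summable u ∧ ∀ z : ℂ, ‖z‖ ≤ ρ → ∀ t ∈ Set.Icc r R, ∀ l : ℕ,
      ‖((l + i).choose i : ℂ) * poissonWeight (z + l) t‖ ≤ u l := by
  obtain ⟨u, hu, h⟩ := exists_summable_bound_choose_mul_inv_Gamma i ρ R (hr.le.trans hrR)
  refine ⟨fun l => Real.exp (ρ * (|Real.log r| + |Real.log R|)) * u l, hu.mul_left _, ?_⟩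
  intro z hz t ht l
  have ht0 : 0 < t := hr.trans_le ht.1
  have h1 : t ^ z.re ≤ Real.exp (ρ * (|Real.log r| + |Real.log R|)) := by
    rw [Real.rpow_def_of_pos ht0, Real.exp_le_exp]
    have hl : |Real.log t| ≤ |Real.log r| + |Real.log R| := by
      have a := Real.log_le_log hr ht.1
      have b := Real.log_le_log ht0 ht.2
      rw [abs_le]
      constructor
      · linarith [neg_abs_le (Real.log r), abs_nonneg (Real.log R)]
      · linarith [le_abs_self (Real.log R), abs_nonneg (Real.log r)]
    calc Real.log t * z.re ≤ |Real.log t * z.re| := le_abs_self _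
      _ = |z.re| * |Real.log t| := by rw [abs_mul, mul_comm]
      _ ≤ ρ * (|Real.log r| + |Real.log R|) := by
        gcongr
        · exact (norm_nonneg z).trans hz
        · exact (Complex.abs_re_le_norm z).trans hz
  have h2 : Real.exp (-t) ≤ 1 := Real.exp_le_one_iff.2 (by linarith)
  rw [norm_mul, norm_poissonWeight_add ht0, Complex.norm_natCast]
  calc _ = Real.exp (-t) * t ^ z.re *
        (((l + i).choose i : ℝ) * t ^ l * ‖(Complex.Gamma (z + l + 1))⁻¹‖) := by ring
    _ ≤ 1 * Real.exp (ρ * (|Real.log r| + |Real.log R|)) *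
        (((l + i).choose i : ℝ) * R ^ l * ‖(Complex.Gamma (z + l + 1))⁻¹‖) := by
        gcongr
        exact ht.2
    _ ≤ Real.exp (ρ * (|Real.log r| + |Real.log R|)) * u l := by
        rw [one_mul]
        exact mul_le_mul_of_nonneg_left (h z hz l) (Real.exp_pos _).le

lemma summable_poissonTail (i : ℕ) (z : ℂ) {t : ℝ} (ht : 0 < t) :
    Summable fun l : ℕ => ((l + i).choose i : ℂ) * poissonWeight (z + l) t := by
  obtain ⟨u, hu, h⟩ := exists_summable_bound_poissonTail i ‖z‖ ht le_rfl
  exact hu.of_norm_bounded fun l => h z le_rfl t ⟨le_rfl, le_rfl⟩ l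

lemma differentiable_poissonWeight {t : ℝ} (ht : 0 < t) :
    Differentiable ℂ fun z => poissonWeight z t := by
  have h0 : (t : ℂ) ≠ 0 := by exact_mod_cast ht.ne'
  unfold poissonWeight
  simp_rw [div_eq_mul_inv]
  refine (differentiable_const _).mul (Differentiable.mul ?_ ?_)
  · exact fun z => (differentiableAt_id).const_cpow (Or.inl h0)
  · exact Complex.differentiable_one_div_Gamma.comp (differentiable_id.add (differentiable_const 1))

/-- A locally uniformly convergent series of entire functions. At `t = 0` this fails already for a
single weight, since `0 ^ z` jumps at `z = 0`. -/
lemma differentiable_poissonTail (i : ℕ) {t : ℝ} (ht : 0 < t) :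
    Differentiable ℂ fun m => poissonTail i m t := by
  intro m
  obtain ⟨u, hu, h⟩ := exists_summable_bound_poissonTail i (‖m‖ + 1 + i) ht le_rfl
  have hd : DifferentiableOn ℂ (fun w => ∑' l : ℕ, ((l + i).choose i : ℂ) *
      poissonWeight (w + i + l) t) (Metric.ball m 1) := by
    refine Complex.differentiableOn_tsum_of_summable_norm hu (fun l => ?_) Metric.isOpen_ball
      (fun l w hw => h (w + i) ?_ t ⟨le_rfl, le_rfl⟩ l)
    · exact ((differentiable_const _).mul ((differentiable_poissonWeight ht).comp
        ((differentiable_id.add (differentiable_const _)).add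
          (differentiable_const _)))).differentiableOn
    · have h1 : ‖w‖ ≤ ‖m‖ + 1 := by
        have : ‖w - m‖ < 1 := by simpa [dist_eq_norm] using hw
        have := norm_le_norm_add_norm_sub' w m
        linarith
      calc ‖w + i‖ ≤ ‖w‖ + ‖(i : ℂ)‖ := norm_add_le _ _
        _ ≤ _ := by rw [Complex.norm_natCast]; gcongr
  exact hd.differentiableAt (Metric.ball_mem_nhds m one_pos)

lemma hasDerivAt_poissonWeight (z : ℂ) {t : ℝ} (ht : 0 < t) :
    HasDerivAt (poissonWeight z) (poissonWeight (z - 1) t - poissonWeight z t) t := by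
  have h0 : (t : ℂ) ≠ 0 := by exact_mod_cast ht.ne'
  have h1 : HasDerivAt (fun w : ℂ => Complex.exp (-w) * (w ^ z / Complex.Gamma (z + 1)))
      (-Complex.exp (-(t : ℂ)) * ((t : ℂ) ^ z / Complex.Gamma (z + 1)) +
        Complex.exp (-(t : ℂ)) * (z * (t : ℂ) ^ (z - 1) / Complex.Gamma (z + 1))) (t : ℂ) := by
    have ha : HasDerivAt (fun w : ℂ => Complex.exp (-w)) (-Complex.exp (-(t : ℂ))) (t : ℂ) := by
      simpa using (hasDerivAt_neg (t : ℂ)).cexp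
    have hb : HasDerivAt (fun w : ℂ => w ^ z) (z * (t : ℂ) ^ (z - 1)) (t : ℂ) := by
      simpa using (hasDerivAt_id (t : ℂ)).cpow_const (c := z) (Or.inl (by simpa using ht))
    exact ha.mul (hb.div_const _)
  have h2 := h1.comp_ofReal
  have h3 : z / Complex.Gamma (z + 1) = 1 / Complex.Gamma z := by
    rw [one_div, Complex.one_div_Gamma_eq_self_mul_one_div_Gamma_add_one z, div_eq_mul_inv]
  refine HasDerivAt.congr_deriv (f := poissonWeight z) h2 ?_
  unfold poissonWeight
  rw [sub_add_cancel, mul_div_right_comm z, h3]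
  ring

lemma hasDerivAt_poissonTail (i : ℕ) (m : ℂ) {t : ℝ} (ht : 0 < t) :
    HasDerivAt (poissonTail i m) (poissonTail i (m - 1) t - poissonTail i m t) t := by
  have hr : 0 < t / 2 := by positivity
  have hrR : t / 2 ≤ 2 * t := by linarith
  obtain ⟨u, hu, h⟩ := exists_summable_bound_poissonTail i ‖m + i‖ hr hrR
  obtain ⟨v, hv, h'⟩ := exists_summable_bound_poissonTail i ‖m - 1 + i‖ hr hrR
  have key := hasDerivAt_tsum_of_isPreconnected (𝕜 := ℝ) (F := ℂ) (u := fun l => v l + u l)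
    (g := fun l s => ((l + i).choose i : ℂ) * poissonWeight (m + i + l) s)
    (g' := fun l s => ((l + i).choose i : ℂ) * poissonWeight (m - 1 + i + l) s -
      ((l + i).choose i : ℂ) * poissonWeight (m + i + l) s)
    (t := Set.Ioo (t / 2) (2 * t)) (y₀ := t) (y := t) (hv.add hu) isOpen_Ioo isPreconnected_Ioo
    ?_ ?_ ⟨by linarith, by linarith⟩ (summable_poissonTail i (m + i) ht)
    ⟨by linarith, by linarith⟩
  · refine HasDerivAt.congr_deriv (f := poissonTail i m) key ?_
    rw [(summable_poissonTail i (m - 1 + i) ht).tsum_sub (summable_poissonTail i (m + i) ht)]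
    rfl
  · intro l s hs
    have := (hasDerivAt_poissonWeight (m + i + l) (hr.trans hs.1)).const_mul
      ((l + i).choose i : ℂ)
    refine this.congr_deriv ?_
    rw [mul_sub, show m + i + l - 1 = m - 1 + i + l by ring]
  · intro l s hs
    exact (norm_sub_le _ _).trans (add_le_add (h' _ le_rfl s ⟨hs.1.le, hs.2.le⟩ l)
      (h _ le_rfl s ⟨hs.1.le, hs.2.le⟩ l))

lemma poissonWeight_zero_right {z : ℂ} (hz : z ≠ 0) : poissonWeight z 0 = 0 := by
  simp [poissonWeight, Complex.zero_cpow hz]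

lemma summable_poissonTail_of_nonneg (i : ℕ) (z : ℂ) {t : ℝ} (ht : 0 ≤ t) :
    Summable fun l : ℕ => ((l + i).choose i : ℂ) * poissonWeight (z + l) t := by
  -- At time zero at most one term survives, the one of index zero.
  rcases ht.eq_or_lt with rfl | ht
  · by_cases h : ∃ l : ℕ, z + l = 0
    · obtain ⟨l, hl⟩ := h
      refine summable_of_ne_finset_zero (s := {l}) fun k hk => ?_
      rw [poissonWeight_zero_right, mul_zero]
      intro h0
      apply hk
      rw [Finset.mem_singleton]
      have : (k : ℂ) = l := by linear_combination h0 - hl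
      exact_mod_cast this
    · push Not at h
      simp_rw [poissonWeight_zero_right (h _), mul_zero]
      exact summable_zero
  · exact summable_poissonTail i z ht

lemma poissonTail_zero_sub (m : ℂ) {t : ℝ} (ht : 0 ≤ t) :
    poissonTail 0 m t - poissonTail 0 (m + 1) t = poissonWeight m t := by
  have h := (summable_poissonTail_of_nonneg 0 m ht).tsum_eq_zero_add
  have e1 : poissonTail 0 m t = ∑' l : ℕ, ((l + 0).choose 0 : ℂ) * poissonWeight (m + l) t := by
    simp [poissonTail]
  rw [e1, h]
  simp [poissonTail, add_assoc, add_comm (1 : ℂ)]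

/-- Pascal's rule for the coefficients: a difference in the index undoes one summation. -/
lemma poissonTail_succ_sub (i : ℕ) (m : ℂ) {t : ℝ} (ht : 0 ≤ t) :
    poissonTail (i + 1) m t - poissonTail (i + 1) (m + 1) t = poissonTail i (m + 1) t := by
  have s1 := summable_poissonTail_of_nonneg (i + 1) (m + (i + 1 : ℕ)) ht
  have s2 := summable_poissonTail_of_nonneg (i + 1) (m + 1 + (i + 1 : ℕ)) ht
  have s3 := summable_poissonTail_of_nonneg i (m + 1 + i) ht
  unfold poissonTail
  rw [s1.tsum_eq_zero_add, s3.tsum_eq_zero_add, add_sub_assoc,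
    ← ((summable_nat_add_iff 1).2 s1).tsum_sub s2]
  congr 1
  · simp only [zero_add, Nat.choose_self, Nat.cast_zero, add_zero]
    congr 2
    push_cast; ring
  · refine tsum_congr fun l => ?_
    have e1 : m + ((i + 1 : ℕ) : ℂ) + ((l + 1 : ℕ) : ℂ) = m + 1 + i + ((l + 1 : ℕ) : ℂ) := by
      push_cast; ring
    have e2 : m + 1 + ((i + 1 : ℕ) : ℂ) + (l : ℂ) = m + 1 + i + ((l + 1 : ℕ) : ℂ) := by
      push_cast; ring
    have e3 : (l + 1 + (i + 1)).choose (i + 1) =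
        (l + 1 + i).choose i + (l + (i + 1)).choose (i + 1) := by
      rw [show l + 1 + (i + 1) = (l + 1 + i) + 1 by ring, Nat.choose_succ_succ,
        show l + (i + 1) = l + 1 + i by ring]
    rw [e1, e2, e3]
    push_cast
    ring

lemma poissonTail_zero_right (i : ℕ) {m : ℂ} (hm : 0 < m.re) : poissonTail i m 0 = 0 := by
  unfold poissonTail
  convert tsum_zero with l
  rw [poissonWeight_zero_right, mul_zero]
  intro h
  have := congrArg Complex.re h
  simp at this
  have h1 : (0 : ℝ) ≤ i := by positivity
  have h2 : (0 : ℝ) ≤ l := by positivity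
  linarith

lemma continuousOn_poissonTail (i : ℕ) {m : ℂ} (hm : 0 < m.re) :
    ContinuousOn (poissonTail i m) (Set.Ici 0) := by
  intro t ht
  rcases (Set.mem_Ici.1 ht).eq_or_lt with rfl | ht
  · obtain ⟨u, hu, h⟩ := exists_summable_bound_choose_mul_inv_Gamma i ‖m + i‖ 1 zero_le_one
    have hu0 : 0 ≤ ∑' l, u l := tsum_nonneg fun l => le_trans (by positivity) (h _ le_rfl l)
    have hb : ∀ t ∈ Set.Ioc (0 : ℝ) 1, ‖poissonTail i m t‖ ≤ t ^ (m + i).re * ∑' l, u l := by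
      intro t ht
      rw [← tsum_mul_left]
      refine tsum_of_norm_bounded (hu.mul_left _).hasSum fun l => ?_
      rw [norm_mul, norm_poissonWeight_add ht.1, Complex.norm_natCast]
      have h2 : Real.exp (-t) ≤ 1 := Real.exp_le_one_iff.2 (by linarith [ht.1])
      have ht0 := ht.1
      calc _ = Real.exp (-t) * t ^ (m + i).re *
            (((l + i).choose i : ℝ) * t ^ l * ‖(Complex.Gamma (m + i + l + 1))⁻¹‖) := by ring
        _ ≤ 1 * t ^ (m + i).re *
            (((l + i).choose i : ℝ) * 1 ^ l * ‖(Complex.Gamma (m + i + l + 1))⁻¹‖) := by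
            gcongr
            exact ht.2
        _ ≤ t ^ (m + i).re * u l := by
            rw [one_mul]
            exact mul_le_mul_of_nonneg_left (h _ le_rfl l) (by positivity)
    have hre : 0 < (m + i).re := by
      have : (0 : ℝ) ≤ i := by positivity
      simp; linarith
    rw [ContinuousWithinAt, poissonTail_zero_right i hm]
    have hlim : Tendsto (fun t : ℝ => t ^ (m + i).re * ∑' l, u l) (𝓝[Set.Ici 0] 0) (𝓝 0) := by
      have : Tendsto (fun t : ℝ => t ^ (m + i).re * ∑' l, u l) (𝓝 0)
          (𝓝 (0 ^ (m + i).re * ∑' l, u l)) :=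
        (Real.continuousAt_rpow_const 0 _ (Or.inr hre.le)).tendsto.mul_const _
      rw [Real.zero_rpow hre.ne', zero_mul] at this
      exact this.mono_left nhdsWithin_le_nhds
    refine squeeze_zero_norm' ?_ hlim
    have h1 : Set.Iic (1 : ℝ) ∈ 𝓝[Set.Ici 0] (0 : ℝ) :=
      mem_nhdsWithin_of_mem_nhds (Iic_mem_nhds one_pos)
    filter_upwards [self_mem_nhdsWithin, h1] with t ht0 ht1
    rcases (Set.mem_Ici.1 ht0).eq_or_lt with rfl | ht0
    · rw [poissonTail_zero_right i hm, norm_zero]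
      positivity
    · exact hb t ⟨ht0, ht1⟩
  · exact (hasDerivAt_poissonTail i m ht).continuousAt.continuousWithinAt

lemma hasDerivAt_poissonTail_zero (m : ℂ) {t : ℝ} (ht : 0 < t) :
    HasDerivAt (poissonTail 0 m) (poissonWeight (m - 1) t) t := by
  refine (hasDerivAt_poissonTail 0 m ht).congr_deriv ?_
  have := poissonTail_zero_sub (m - 1) ht.le
  rwa [sub_add_cancel] at this

/-- The time derivative is a difference in the index, and that difference undoes one summation. The
tails are therefore iterated antiderivatives of a Poisson weight. -/
lemma hasDerivAt_poissonTail_succ (i : ℕ) (m : ℂ) {t : ℝ} (ht : 0 < t) :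
    HasDerivAt (poissonTail (i + 1) m) (poissonTail i m t) t := by
  refine (hasDerivAt_poissonTail (i + 1) m ht).congr_deriv ?_
  have := poissonTail_succ_sub i (m - 1) ht.le
  rwa [sub_add_cancel] at this

lemma intervalIntegrable_poissonWeight {z : ℂ} (hz : -1 < z.re) (a b : ℝ) :
    IntervalIntegrable (poissonWeight z) volume a b := by
  have h := (intervalIntegral.intervalIntegrable_cpow' (a := a) (b := b) hz).div_const
    (Complex.Gamma (z + 1))
  exact h.continuousOn_mul (Continuous.continuousOn (by fun_prop))

/-- Cauchy's formula for repeated integration. -/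
lemma integral_sub_pow_mul_of_hasDerivAt {V : ℕ → ℝ → ℂ} {T : ℝ} (hT : 0 ≤ T)
    (hd : ∀ n, ∀ t, 0 < t → HasDerivAt (V (n + 1)) (V n t) t)
    (hc : ∀ n, ContinuousOn (V (n + 1)) (Set.Ici 0)) (h0 : ∀ n, V (n + 1) 0 = 0)
    (hi : IntervalIntegrable (V 0) volume 0 T) (i n : ℕ) :
    ∫ s in (0 : ℝ)..T, ((T : ℂ) - s) ^ i / (i ! : ℂ) * V n s = V (n + i + 1) T := by
  have hsub : Set.uIcc 0 T ⊆ Set.Ici 0 := by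
    rw [Set.uIcc_of_le hT]; exact Set.Icc_subset_Ici_self
  have h_int : ∀ n, IntervalIntegrable (V n) volume 0 T := by
    intro n
    cases n with
    | zero => exact hi
    | succ n => exact ((hc n).mono hsub).intervalIntegrable
  have h_pos : ∀ x ∈ Set.Ioo (min 0 T) (max 0 T), 0 < x := by
    intro x hx; rw [min_eq_left hT] at hx; exact hx.1
  induction i generalizing n with
  | zero =>
    simp only [pow_zero, Nat.factorial_zero, Nat.cast_one, div_one, one_mul, add_zero]
    rw [intervalIntegral.integral_eq_sub_of_hasDeriv_right ((hc n).mono hsub)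
      (fun x hx => (hd n x (h_pos x hx)).hasDerivWithinAt) (h_int n), h0, sub_zero]
  | succ i ih =>
    have hu : ∀ x : ℝ, HasDerivAt (fun s : ℝ => ((T : ℂ) - s) ^ (i + 1) / ((i + 1)! : ℂ))
        (-(((T : ℂ) - x) ^ i / (i ! : ℂ))) x := by
      intro x
      have h1 : HasDerivAt (fun s : ℝ => (T : ℂ) - s) (-1) x := by
        simpa using (hasDerivAt_id x).ofReal_comp.const_sub (T : ℂ)
      refine ((h1.pow (i + 1)).div_const ((i + 1)! : ℂ)).congr_deriv ?_
      have h2 : (i ! : ℂ) ≠ 0 := by exact_mod_cast Nat.factorial_ne_zero i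
      have h3 : (i + 1 : ℂ) ≠ 0 := by exact_mod_cast Nat.succ_ne_zero i
      rw [Nat.factorial_succ]
      push_cast
      field_simp
    -- Integration by parts: the boundary term at `T` vanishes through the power of `T - s`, the one
    -- at zero through `h0`.
    rw [intervalIntegral.integral_mul_deriv_eq_deriv_mul_of_hasDerivAt
      (fun x _ => (hu x).continuousAt.continuousWithinAt) ((hc n).mono hsub)
      (fun x _ => hu x) (fun x hx => hd n x (h_pos x hx))
      (Continuous.intervalIntegrable (by fun_prop) _ _) (h_int n)]
    simp only [neg_mul, intervalIntegral.integral_neg, sub_self, h0]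
    rw [ih (n + 1)]
    simp
    congr 1
    ring

lemma integral_sub_pow_mul_poissonWeight (i : ℕ) {z : ℂ} (hz : -1 < z.re) {T : ℝ} (hT : 0 ≤ T) :
    ∫ s in (0 : ℝ)..T, ((T : ℂ) - s) ^ i / (i ! : ℂ) * poissonWeight z s =
      poissonTail i (z + 1) T := by
  have hm : 0 < (z + 1).re := by simp; linarith
  have := integral_sub_pow_mul_of_hasDerivAt
    (V := fun n => Nat.casesOn n (poissonWeight z) (fun k => poissonTail k (z + 1))) hT
    (fun n t ht => ?_) (fun n => continuousOn_poissonTail n hm)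
    (fun n => poissonTail_zero_right n hm) (intervalIntegrable_poissonWeight hz 0 T) i 0
  · simpa using this
  · cases n with
    | zero => simpa using hasDerivAt_poissonTail_zero (z + 1) ht
    | succ n => exact hasDerivAt_poissonTail_succ n (z + 1) ht

/-! ### Integer arguments -/

lemma poissonWeight_natCast (q : ℕ) (t : ℝ) :
    poissonWeight q t = Complex.exp (-(t : ℂ)) * ((t : ℂ) ^ q / (q ! : ℂ)) := by
  rw [poissonWeight, Complex.cpow_natCast, Complex.Gamma_nat_eq_factorial]

lemma poissonWeight_of_neg {k : ℤ} (hk : k < 0) (t : ℝ) : poissonWeight k t = 0 := by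
  obtain ⟨n, rfl⟩ : ∃ n : ℕ, k = -(n : ℤ) - 1 := ⟨(-k - 1).toNat, by omega⟩
  have : (((-(n : ℤ) - 1 : ℤ) : ℂ)) + 1 = -(n : ℂ) := by push_cast; ring
  -- At its poles `Complex.Gamma` has the value zero, and division by zero gives zero; this matches
  -- the zeros of the entire function `1/Γ`.
  rw [poissonWeight, this, Complex.Gamma_neg_nat_eq_zero, div_zero, mul_zero]

lemma continuous_poissonWeight_intCast (k : ℤ) : Continuous (poissonWeight k) := by
  rcases lt_or_ge k 0 with hk | hk
  · rw [show poissonWeight k = fun _ => 0 from funext (poissonWeight_of_neg hk)]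
    exact continuous_const
  · lift k to ℕ using hk
    have : poissonWeight ((k : ℤ) : ℂ) =
        fun t : ℝ => Complex.exp (-(t : ℂ)) * ((t : ℂ) ^ k / (k ! : ℂ)) :=
      funext fun t => by simpa using poissonWeight_natCast k t
    rw [this]
    fun_prop

lemma norm_poissonWeight_natCast_le_one (q : ℕ) {t : ℝ} (ht : 0 ≤ t) :
    ‖poissonWeight q t‖ ≤ 1 := by
  rw [poissonWeight_natCast, norm_mul, norm_div, norm_pow, Complex.norm_real,
    Real.norm_of_nonneg ht, Complex.norm_natCast, ← Complex.ofReal_neg, Complex.norm_exp_ofReal]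
  calc Real.exp (-t) * (t ^ q / (q ! : ℝ)) ≤ Real.exp (-t) * Real.exp t := by
        gcongr; exact Real.pow_div_factorial_le_exp _ ht q
    _ = 1 := by rw [← Real.exp_add]; simp

/-- The weights of negative index vanish, so the tail is the full mass of the Poisson law. -/
lemma poissonTail_zero_of_nonpos {k : ℤ} (hk : k ≤ 0) {t : ℝ} (ht : 0 ≤ t) :
    poissonTail 0 k t = 1 := by
  obtain ⟨n, rfl⟩ : ∃ n : ℕ, k = -(n : ℤ) := ⟨(-k).toNat, by omega⟩
  clear hk
  induction n with
  | zero =>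
    have h := NormedSpace.expSeries_div_hasSum_exp (t : ℂ)
    rw [← Complex.exp_eq_exp_ℂ] at h
    have h1 := (h.mul_left (Complex.exp (-(t : ℂ)))).tsum_eq
    rw [← Complex.exp_add, neg_add_cancel, Complex.exp_zero] at h1
    rw [← h1, poissonTail]
    refine tsum_congr fun l => ?_
    simp [poissonWeight_natCast]
  | succ n ih =>
    have h := poissonTail_zero_sub ((-((n + 1 : ℕ) : ℤ) : ℤ) : ℂ) ht
    rw [poissonWeight_of_neg (by omega), sub_eq_zero] at h
    rw [h, ← show ((-(n : ℤ) : ℤ) : ℂ) = ((-((n + 1 : ℕ) : ℤ) : ℤ) : ℂ) + 1 by push_cast; ring, ih]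

lemma continuousOn_poissonTail_intCast (i : ℕ) (k : ℤ) :
    ContinuousOn (poissonTail i k) (Set.Ici 0) := by
  induction i generalizing k with
  | zero =>
    -- Descent in `k`: `n` bounds the number of unit shifts needed to reach a positive index.
    obtain ⟨n, hn⟩ : ∃ n : ℕ, 1 - k ≤ n := ⟨(1 - k).toNat, by omega⟩
    induction n generalizing k with
    | zero =>
      apply continuousOn_poissonTail
      rw [Complex.intCast_re]
      exact_mod_cast (by push_cast at hn; omega : 0 < k)
    | succ n ih =>
      have := (ih (k + 1) (by push_cast at hn ⊢; omega)).add
        (continuous_poissonWeight_intCast k).continuousOn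
      refine this.congr fun t ht => ?_
      have h := poissonTail_zero_sub (k : ℂ) (Set.mem_Ici.1 ht)
      simp only [Pi.add_apply]
      rw [← h]; push_cast; ring
  | succ i ihi =>
    obtain ⟨n, hn⟩ : ∃ n : ℕ, 1 - k ≤ n := ⟨(1 - k).toNat, by omega⟩
    induction n generalizing k with
    | zero =>
      apply continuousOn_poissonTail
      rw [Complex.intCast_re]
      exact_mod_cast (by push_cast at hn; omega : 0 < k)
    | succ n ih =>
      have := (ih (k + 1) (by push_cast at hn ⊢; omega)).add (ihi (k + 1))
      refine this.congr fun t ht => ?_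
      have h := poissonTail_succ_sub i (k : ℂ) (Set.mem_Ici.1 ht)
      simp only [Pi.add_apply]
      push_cast
      rw [← h]; ring

/-- On a bounded time interval the iterated tails are bounded uniformly in `k ≥ -n`. -/
lemma exists_norm_poissonTail_intCast_le (i n : ℕ) {T : ℝ} (hT : 0 ≤ T) :
    ∃ C, ∀ k : ℤ, -(n : ℤ) ≤ k → ∀ t ∈ Set.Icc 0 T, ‖poissonTail i k t‖ ≤ C := by
  -- For positive `k` the repeated integral of a weight bounded by one gives a bound free of `k`;
  -- only finitely many `k` remain, each handled by compactness.
  have h1 : ∀ k : ℤ, 0 < k → ∀ t ∈ Set.Icc 0 T, ‖poissonTail i k t‖ ≤ T ^ i / (i ! : ℝ) * T := by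
    intro k hk t ht
    obtain ⟨q, rfl⟩ : ∃ q : ℕ, k = (q : ℤ) + 1 := ⟨(k - 1).toNat, by omega⟩
    have h := integral_sub_pow_mul_poissonWeight i (z := (q : ℂ))
      (by simp; linarith [q.cast_nonneg (α := ℝ)]) ht.1
    push_cast
    rw [← h]
    refine (intervalIntegral.norm_integral_le_of_norm_le_const (C := T ^ i / (i ! : ℝ))
      fun s hs => ?_).trans ?_
    · rw [Set.uIoc_of_le ht.1] at hs
      rw [norm_mul, norm_div, norm_pow, ← Complex.ofReal_sub, Complex.norm_real,
        Complex.norm_natCast, Real.norm_of_nonneg (by linarith [hs.2])]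
      calc (t - s) ^ i / (i ! : ℝ) * ‖poissonWeight q s‖ ≤ T ^ i / (i ! : ℝ) * 1 := by
            gcongr
            · linarith [hs.2]
            · linarith [hs.1, ht.2]
            · exact norm_poissonWeight_natCast_le_one q hs.1.le
        _ = _ := mul_one _
    · rw [sub_zero, abs_of_nonneg ht.1]
      gcongr
      exact ht.2
  choose B hB using fun k : ℤ => isCompact_Icc.exists_bound_of_continuousOn
    ((continuousOn_poissonTail_intCast i k).mono
      (Set.Icc_subset_Ici_self : Set.Icc 0 T ⊆ Set.Ici 0))
  refine ⟨T ^ i / (i ! : ℝ) * T + ∑ k ∈ Finset.Icc (-(n : ℤ)) 0, |B k|, fun k hk t ht => ?_⟩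
  have hnn : 0 ≤ ∑ k ∈ Finset.Icc (-(n : ℤ)) 0, |B k| := Finset.sum_nonneg fun _ _ => abs_nonneg _
  rcases lt_or_ge 0 k with h | h
  · linarith [h1 k h t ht]
  · have h2 : |B k| ≤ ∑ k ∈ Finset.Icc (-(n : ℤ)) 0, |B k| :=
      Finset.single_le_sum (f := fun k => |B k|) (fun _ _ => abs_nonneg _)
        (Finset.mem_Icc.2 ⟨hk, h⟩)
    have h3 : 0 ≤ T ^ i / (i ! : ℝ) * T := by positivity
    linarith [hB k t ht, le_abs_self (B k)]

/-! ### Differences in the index -/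

/-- The negated forward difference `h(m) - h(m+1)`. -/
def negDiff (h : ℂ → ℂ) (m : ℂ) : ℂ := h m - h (m + 1)

lemma negDiff_iterate_eq_sum (j : ℕ) (h : ℂ → ℂ) (m : ℂ) :
    negDiff^[j] h m = ∑ l ∈ Finset.range (j + 1), (-1) ^ l * (j.choose l : ℂ) * h (m + l) := by
  have h1 : negDiff^[j] h m = (-1) ^ j * (fwdDiff 1)^[j] h m := by
    induction j generalizing m with
    | zero => simp
    | succ j ih =>
      rw [Function.iterate_succ_apply', Function.iterate_succ_apply', negDiff, ih, ih, fwdDiff]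
      ring
  rw [h1, fwdDiff_iter_eq_sum_shift, Finset.mul_sum]
  refine Finset.sum_congr rfl fun l hl => ?_
  have hl' : l ≤ j := Nat.lt_succ_iff.1 (Finset.mem_range.1 hl)
  obtain ⟨k, rfl⟩ := Nat.exists_eq_add_of_le hl'
  rw [Nat.add_sub_cancel_left, zsmul_eq_mul, nsmul_eq_mul, mul_one]
  push_cast
  rw [pow_add]
  have : ((-1 : ℂ) ^ k) * (-1) ^ k = 1 := by rw [← mul_pow]; simp
  linear_combination (-1) ^ l * ((l + k).choose l : ℂ) * h (m + l) * this

lemma inv_Gamma_mul_ascPochhammer {m : ℂ} (hm : -1 < m.re) (l : ℕ) :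
    (Complex.Gamma (m + 1))⁻¹ * ((ascPochhammer ℂ l).eval (m + 1))⁻¹ =
      (Complex.Gamma (m + l + 1))⁻¹ := by
  have hre : 0 < (m + 1).re := by simp; linarith
  induction l with
  | zero => simp
  | succ l ih =>
    have hne : m + l + 1 ≠ 0 := by
      intro h
      have := congrArg Complex.re h
      simp at this
      linarith [l.cast_nonneg (α := ℝ)]
    rw [ascPochhammer_succ_eval, mul_inv, ← mul_assoc, ih]
    push_cast
    rw [show m + (l + 1) + 1 = (m + l + 1) + 1 by ring, Complex.Gamma_add_one _ hne, mul_inv,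
      show m + 1 + l = m + l + 1 by ring, mul_comm]

lemma ascPochhammer_eval_neg_natCast (j l : ℕ) :
    (ascPochhammer ℂ l).eval (-(j : ℂ)) = (-1) ^ l * (l ! * j.choose l : ℂ) := by
  rw [ascPochhammer_eval_neg_eq_descPochhammer, descPochhammer_eval_eq_descFactorial,
    Nat.descFactorial_eq_factorial_mul_choose]
  push_cast
  rfl

/-- For a nonpositive first index the series of `greenF` is finite. -/
lemma greenF_neg_natCast (j : ℕ) {m : ℂ} (hm : -1 < m.re) {s : ℝ}
    (hs : 0 < s ∨ ∃ n : ℕ, m = n) :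
    greenF (-(j : ℤ)) m s = negDiff^[j] (fun z => poissonWeight z s) m := by
  have hpow : ∀ l : ℕ, (s : ℂ) ^ (m + l) = (s : ℂ) ^ m * (s : ℂ) ^ l := by
    intro l
    rcases hs with hs | ⟨n, rfl⟩
    · rw [Complex.cpow_add _ _ (by exact_mod_cast hs.ne'), Complex.cpow_natCast]
    · rw [← Nat.cast_add, Complex.cpow_natCast, Complex.cpow_natCast, pow_add]
  rw [greenF, negDiff_iterate_eq_sum, tsum_eq_sum (s := Finset.range (j + 1)), Finset.mul_sum]
  · refine Finset.sum_congr rfl fun l _ => ?_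
    have hf : (l ! : ℂ) ≠ 0 := by exact_mod_cast Nat.factorial_ne_zero l
    have hG := inv_Gamma_mul_ascPochhammer hm l
    push_cast
    rw [ascPochhammer_eval_neg_natCast, poissonWeight, hpow,
      div_eq_mul_inv _ (Complex.Gamma (m + l + 1)), ← hG]
    field_simp
  · intro l hl
    have : j < l := by simpa using hl
    push_cast
    rw [ascPochhammer_eval_neg_coe_nat_of_lt this]
    simp

/-- The `j`-fold difference of the `(i+1)`-fold tail of the Poisson weights. -/
def tailEntry (j i : ℕ) (z : ℂ) (t : ℝ) : ℂ := negDiff^[j] (fun m => poissonTail i m t) z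

lemma tailEntry_eq_sum (j i : ℕ) (z : ℂ) (t : ℝ) : tailEntry j i z t =
    ∑ l ∈ Finset.range (j + 1), (-1) ^ l * (j.choose l : ℂ) * poissonTail i (z + l) t :=
  negDiff_iterate_eq_sum j _ z

lemma intervalIntegrable_greenF (j : ℕ) {m : ℂ} (hm : -1 < m.re) {T : ℝ} (hT : 0 ≤ T) :
    IntervalIntegrable (greenF (-(j : ℤ)) m) volume 0 T := by
  have h : IntervalIntegrable (fun s => ∑ l ∈ Finset.range (j + 1),
      (-1) ^ l * (j.choose l : ℂ) * poissonWeight (m + l) s) volume 0 T := by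
    have := IntervalIntegrable.sum (μ := volume) (a := (0 : ℝ)) (b := T) (Finset.range (j + 1))
      (f := fun l s => (-1) ^ l * (j.choose l : ℂ) * poissonWeight (m + l) s) (fun l _ =>
        (intervalIntegrable_poissonWeight (z := m + l)
          (by simp; linarith [l.cast_nonneg (α := ℝ)]) 0 T).const_mul _)
    rwa [show (∑ l ∈ Finset.range (j + 1), fun s : ℝ => (-1) ^ l * (j.choose l : ℂ) *
      poissonWeight (m + l) s) = fun s : ℝ => ∑ l ∈ Finset.range (j + 1),
        (-1) ^ l * (j.choose l : ℂ) * poissonWeight (m + l) s from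
      funext fun s => Finset.sum_apply _ _ _] at this
  refine h.congr fun s hs => ?_
  rw [Set.uIoc_of_le hT] at hs
  rw [greenF_neg_natCast j hm (Or.inl hs.1), negDiff_iterate_eq_sum]

lemma integral_sub_pow_mul_greenF (j i : ℕ) {m : ℂ} (hm : -1 < m.re) {T : ℝ} (hT : 0 ≤ T) :
    ∫ s in (0 : ℝ)..T, ((T : ℂ) - s) ^ i / (i ! : ℂ) * greenF (-(j : ℤ)) m s =
      tailEntry j i (m + 1) T := by
  have hre : ∀ l : ℕ, -1 < (m + l).re := fun l => by
    simp; linarith [l.cast_nonneg (α := ℝ)]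
  have h1 : ∫ s in (0 : ℝ)..T, ((T : ℂ) - s) ^ i / (i ! : ℂ) * greenF (-(j : ℤ)) m s =
      ∫ s in (0 : ℝ)..T, ∑ l ∈ Finset.range (j + 1), (-1) ^ l * (j.choose l : ℂ) *
        (((T : ℂ) - s) ^ i / (i ! : ℂ) * poissonWeight (m + l) s) := by
    rw [intervalIntegral.integral_of_le hT, intervalIntegral.integral_of_le hT]
    refine setIntegral_congr_fun measurableSet_Ioc fun s hs => ?_
    rw [greenF_neg_natCast j hm (Or.inl hs.1), negDiff_iterate_eq_sum, Finset.mul_sum]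
    exact Finset.sum_congr rfl fun l _ => by ring
  rw [h1, intervalIntegral.integral_finsetSum, tailEntry_eq_sum]
  · refine Finset.sum_congr rfl fun l _ => ?_
    rw [intervalIntegral.integral_const_mul, integral_sub_pow_mul_poissonWeight i (hre l) hT]
    congr 2
    ring
  · intro l _
    refine ((intervalIntegrable_poissonWeight (hre l) 0 T).continuousOn_mul ?_).const_mul _
    exact Continuous.continuousOn (by fun_prop)

lemma differentiable_tailEntry (j i : ℕ) {t : ℝ} (ht : 0 < t) :
    Differentiable ℂ fun z => tailEntry j i z t := by
  simp_rw [tailEntry_eq_sum]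
  refine Differentiable.fun_sum fun l _ => (differentiable_const _).mul ?_
  exact (differentiable_poissonTail i ht).comp (differentiable_id.add (differentiable_const _))

/-! ### Integrals of products of two determinants -/

/-- The product of two determinants, expanded over pairs of permutations. -/
lemma Matrix.det_mul_det_eq_sum {n : Type*} [Fintype n] [DecidableEq n] (A B : Matrix n n ℂ) :
    A.det * B.det = ∑ σ : Equiv.Perm n, ∑ τ : Equiv.Perm n,
      ((Equiv.Perm.sign σ : ℤ) : ℂ) * ((Equiv.Perm.sign τ : ℤ) : ℂ) *
        ∏ k, (A (σ k) k * B (τ k) k) := by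
  rw [Matrix.det_apply', Matrix.det_apply', Finset.sum_mul_sum]
  refine Finset.sum_congr rfl fun σ _ => Finset.sum_congr rfl fun τ _ => ?_
  rw [Finset.prod_mul_distrib]
  ring

section Andreief

variable {n : Type*} [Fintype n] [DecidableEq n] {ν : Measure ℝ} [SigmaFinite ν]
  {g f : n → ℝ → ℂ}

lemma integrable_det_mul_det (h : ∀ i j, Integrable (fun s => g i s * f j s) ν) :
    Integrable (fun t : n → ℝ => (Matrix.of fun i k => g i (t k)).det *
      (Matrix.of fun j k => f j (t k)).det) (Measure.pi fun _ => ν) := by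
  simp_rw [Matrix.det_mul_det_eq_sum, Matrix.of_apply]
  exact integrable_finsetSum _ fun σ _ => integrable_finsetSum _ fun τ _ =>
    (Integrable.fintype_prod (f := fun k s => g (σ k) s * f (τ k) s)
      (fun k => h (σ k) (τ k))).const_mul _

/-- **Andréief's identity.** -/
lemma integral_det_mul_det (h : ∀ i j, Integrable (fun s => g i s * f j s) ν) :
    ∫ t : n → ℝ, (Matrix.of fun i k => g i (t k)).det * (Matrix.of fun j k => f j (t k)).det
        ∂(Measure.pi fun _ => ν) =
      ((Fintype.card n)! : ℂ) * (Matrix.of fun j i => ∫ s, g i s * f j s ∂ν).det := by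
  have h_int : ∀ σ τ : Equiv.Perm n, Integrable (fun t : n → ℝ =>
      ((Equiv.Perm.sign σ : ℤ) : ℂ) * ((Equiv.Perm.sign τ : ℤ) : ℂ) *
        ∏ k, (g (σ k) (t k) * f (τ k) (t k))) (Measure.pi fun _ => ν) := fun σ τ =>
    (Integrable.fintype_prod (f := fun k s => g (σ k) s * f (τ k) s)
      (fun k => h (σ k) (τ k))).const_mul _
  simp_rw [Matrix.det_mul_det_eq_sum, Matrix.of_apply]
  rw [integral_finsetSum _ fun σ _ => integrable_finsetSum _ fun τ _ => h_int σ τ]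
  set G : Matrix n n ℂ := Matrix.of fun j i => ∫ s, g i s * f j s ∂ν with hG
  -- For fixed `σ` the sum over `τ` is the determinant with columns permuted by `σ`. The resulting
  -- sign cancels the sign of `σ`, so all `n!` choices of `σ` contribute equally.
  have hσ : ∀ σ : Equiv.Perm n, ∫ t : n → ℝ, ∑ τ : Equiv.Perm n,
      ((Equiv.Perm.sign σ : ℤ) : ℂ) * ((Equiv.Perm.sign τ : ℤ) : ℂ) *
        ∏ k, (g (σ k) (t k) * f (τ k) (t k)) ∂(Measure.pi fun _ => ν) = G.det := by
    intro σ
    rw [integral_finsetSum _ fun τ _ => h_int σ τ]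
    have h1 : ∀ τ : Equiv.Perm n, ∫ t : n → ℝ,
        ((Equiv.Perm.sign σ : ℤ) : ℂ) * ((Equiv.Perm.sign τ : ℤ) : ℂ) *
          ∏ k, (g (σ k) (t k) * f (τ k) (t k)) ∂(Measure.pi fun _ => ν) =
        ((Equiv.Perm.sign σ : ℤ) : ℂ) * (((Equiv.Perm.sign τ : ℤ) : ℂ) *
          ∏ k, (G.submatrix id σ) (τ k) k) := by
      intro τ
      rw [integral_const_mul, integral_fintype_prod_eq_prod (fun k s => g (σ k) s * f (τ k) s),
        mul_assoc]
      rfl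
    simp_rw [h1]
    rw [← Finset.mul_sum, ← Matrix.det_apply', Matrix.det_permute', ← mul_assoc]
    have : ((Equiv.Perm.sign σ : ℤ) : ℂ) * ((Equiv.Perm.sign σ : ℤ) : ℂ) = 1 := by
      rw [← Int.cast_mul]
      simp [← Units.val_mul]
    rw [this, one_mul]
  simp_rw [hσ]
  simp [Fintype.card_perm]

end Andreief

/-! ### The hopping integral as a determinant -/

/-- Passing to `T - t` flips the sign of every factor, and reversing the order of the variables
flips it back. -/
lemma prod_Ioi_sub_eq_prod_rev {N : ℕ} (t : Fin N → ℂ) (T : ℂ) :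
    ∏ j : Fin N, ∏ k ∈ Finset.Ioi j, (t k - t j) =
      ∏ j : Fin N, ∏ k ∈ Finset.Ioi j, ((T - t (Fin.rev k)) - (T - t (Fin.rev j))) := by
  rw [Finset.prod_sigma', Finset.prod_sigma']
  refine Finset.prod_nbij' (fun p => ⟨Fin.rev p.2, Fin.rev p.1⟩)
    (fun p => ⟨Fin.rev p.2, Fin.rev p.1⟩) ?_ ?_ ?_ ?_ ?_
  · simp
  · simp
  · simp
  · simp
  · intro p _
    simp only [Fin.rev_rev]
    ring

/-- Both determinants carry the same column reversal, so its sign appears squared. -/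
lemma hopIntegrand_eq_det_mul_det {N : ℕ} [NeZero N] (y : Fin N → ℤ) (M : ℂ) (T : ℝ)
    (t : Fin N → ℝ) :
    hopIntegrand y M t = (Matrix.of fun i k : Fin N => ((T : ℂ) - (t k : ℂ)) ^ (i : ℕ)).det *
      (Matrix.of fun j k : Fin N =>
        greenF (-(j : ℤ)) ((y 0 : ℂ) - (y j : ℂ) + M - 1) (t k)).det := by
  set A := Matrix.of fun i k : Fin N => ((T : ℂ) - (t k : ℂ)) ^ (i : ℕ) with hA
  set B := Matrix.of fun j k : Fin N =>
    greenF (-(j : ℤ)) ((y 0 : ℂ) - (y j : ℂ) + M - 1) (t k) with hB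
  have h1 : ∏ j : Fin N, ∏ k ∈ Finset.Ioi j, ((t k : ℂ) - (t j : ℂ)) =
      (A.submatrix id Fin.revPerm).det := by
    rw [prod_Ioi_sub_eq_prod_rev (fun k => (t k : ℂ)) T,
      ← Matrix.det_vandermonde (fun k => (T : ℂ) - (t (Fin.rev k) : ℂ)), ← Matrix.det_transpose]
    rfl
  have h2 : (Matrix.of fun j k : Fin N =>
      greenF (-(j : ℤ)) ((y 0 : ℂ) - (y j : ℂ) + M - 1) (t (Fin.rev k))) =
      B.submatrix id Fin.revPerm := rfl
  rw [hopIntegrand, h1, h2, Matrix.det_permute', Matrix.det_permute']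
  have : ((Equiv.Perm.sign (Fin.revPerm (n := N)) : ℤ) : ℂ) *
      ((Equiv.Perm.sign (Fin.revPerm (n := N)) : ℤ) : ℂ) = 1 := by
    rw [← Int.cast_mul]
    simp [← Units.val_mul]
  linear_combination A.det * B.det * this

lemma volume_restrict_Icc_eq_pi (N : ℕ) (T : ℝ) :
    (volume : Measure (Fin N → ℝ)).restrict (Set.Icc 0 fun _ => T) =
      Measure.pi fun _ => (volume : Measure ℝ).restrict (Set.Icc 0 T) := by
  rw [← Measure.restrict_pi_pi, volume_pi, Set.pi_univ_Icc]
  rfl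

lemma re_sub_add_gt {N : ℕ} [NeZero N] {y : Fin N → ℤ} (hy : StrictMono y) {M : ℂ}
    (hM : ((y (Fin.rev 0) - y 0 : ℤ) : ℝ) < M.re) (j : Fin N) :
    -1 < ((y 0 : ℂ) - (y j : ℂ) + M - 1).re := by
  have h : j ≤ Fin.rev 0 := by
    rw [Fin.le_def, Fin.val_rev]
    have := j.isLt
    simp
    omega
  have h1 : (y j : ℝ) ≤ y (Fin.rev 0) := by exact_mod_cast hy.monotone h
  push_cast at hM
  simp
  linarith

lemma integrable_sub_pow_mul_greenF (i j : ℕ) {m : ℂ} (hm : -1 < m.re) {T : ℝ} (hT : 0 ≤ T) :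
    Integrable (fun s : ℝ => ((T : ℂ) - (s : ℂ)) ^ i * greenF (-(j : ℤ)) m s)
      (volume.restrict (Set.Icc 0 T)) := by
  have := (intervalIntegrable_greenF j hm hT).continuousOn_mul
    (g := fun s : ℝ => ((T : ℂ) - (s : ℂ)) ^ i) (Continuous.continuousOn (by fun_prop))
  rwa [intervalIntegrable_iff_integrableOn_Icc_of_le hT] at this

lemma integrableOn_hopIntegrand {N : ℕ} [NeZero N] {y : Fin N → ℤ} (hy : StrictMono y) {M : ℂ}
    (hM : ((y (Fin.rev 0) - y 0 : ℤ) : ℝ) < M.re) {T : ℝ} (hT : 0 ≤ T) :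
    IntegrableOn (hopIntegrand y M) (Set.Icc (0 : Fin N → ℝ) fun _ => T) := by
  rw [IntegrableOn, volume_restrict_Icc_eq_pi, funext (hopIntegrand_eq_det_mul_det y M T)]
  exact integrable_det_mul_det (g := fun (i : Fin N) s => ((T : ℂ) - (s : ℂ)) ^ (i : ℕ))
    (f := fun (j : Fin N) s => greenF (-(j : ℤ)) ((y 0 : ℂ) - (y j : ℂ) + M - 1) s)
    fun i j => integrable_sub_pow_mul_greenF i j (re_sub_add_gt hy hM j) hT

lemma prod_factorial_succ (N : ℕ) :
    ∏ j : Fin N, (((j : ℕ) + 1)! : ℂ) = (N ! : ℂ) * ∏ j : Fin N, ((j : ℕ)! : ℂ) := by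
  induction N with
  | zero => simp
  | succ N ih =>
    rw [Fin.prod_univ_castSucc, Fin.prod_univ_castSucc (f := fun j : Fin (N + 1) => ((j : ℕ)! : ℂ))]
    simp only [Fin.val_castSucc, Fin.val_last]
    rw [ih]
    ring

/-- The prefactor splits as `N!`, which cancels the factor in Andréief's identity, times the product
of the `i!` that normalise the kernels `(T - s)^i / i!`. -/
lemma hopIntegral_eq_det {N : ℕ} [NeZero N] {y : Fin N → ℤ} (hy : StrictMono y) {M : ℂ}
    (hM : ((y (Fin.rev 0) - y 0 : ℤ) : ℝ) < M.re) {T : ℝ} (hT : 0 ≤ T) :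
    hopIntegral y T M =
      (Matrix.of fun j i : Fin N => tailEntry j i (M + y 0 - y j) T).det := by
  rw [hopIntegral, volume_restrict_Icc_eq_pi, funext (hopIntegrand_eq_det_mul_det y M T),
    integral_det_mul_det (g := fun (i : Fin N) s => ((T : ℂ) - (s : ℂ)) ^ (i : ℕ))
    (f := fun (j : Fin N) s => greenF (-(j : ℤ)) ((y 0 : ℂ) - (y j : ℂ) + M - 1) s)
    fun i j => integrable_sub_pow_mul_greenF i j (re_sub_add_gt hy hM j) hT]
  have h1 : (Matrix.of fun j i : Fin N => tailEntry j i (M + y 0 - y j) T) =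
      Matrix.of fun j i : Fin N => ((i : ℕ)! : ℂ)⁻¹ *
        (Matrix.of fun j i : Fin N => ∫ s, ((T : ℂ) - (s : ℂ)) ^ (i : ℕ) *
          greenF (-(j : ℤ)) ((y 0 : ℂ) - (y j : ℂ) + M - 1) s
            ∂volume.restrict (Set.Icc 0 T)) j i := by
    ext j i
    have h2 := integral_sub_pow_mul_greenF j i (re_sub_add_gt hy hM j) hT
    rw [show (y 0 : ℂ) - (y j : ℂ) + M - 1 + 1 = M + y 0 - y j by ring] at h2
    rw [Matrix.of_apply, ← h2, Matrix.of_apply, Matrix.of_apply, integral_Icc_eq_integral_Ioc,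
      ← intervalIntegral.integral_of_le hT, ← intervalIntegral.integral_const_mul]
    refine intervalIntegral.integral_congr fun s _ => ?_
    ring
  rw [h1, Matrix.det_mul_row, prod_factorial_succ, Fintype.card_fin, Finset.prod_inv_distrib]
  have h3 : (N ! : ℂ) ≠ 0 := by exact_mod_cast Nat.factorial_ne_zero N
  rw [← mul_assoc]
  congr 1
  field_simp

/-! ### The step initial condition -/

/-- Here row `j` involves only weights of index `M - 1 - p` with `p ≤ j`, with binomial
coefficients, so a unipotent lower triangular factor `C` splits off. Reversing rows and columns of
`P` together leaves powers `t^(M - N + p)`: a Vandermonde matrix up to row and column factors. -/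
lemma hopIntegrand_step {N : ℕ} [NeZero N] {y : Fin N → ℤ}
    (hy : ∀ j : Fin N, y j = -(N : ℤ) + ((j : ℤ) + 1)) {M : ℕ} (hM : N ≤ M) (t : Fin N → ℝ) :
    hopIntegrand y M t = (∏ j : Fin N, ((M - N + (j : ℕ))! : ℂ))⁻¹ *
      (((∏ j : Fin N, ∏ k ∈ Finset.Ioi j, (t k - t j) ^ 2) *
        ∏ j : Fin N, (t j ^ (M - N) * Real.exp (-(t j))) : ℝ) : ℂ) := by
  have hval : ∀ j : Fin N, (y 0 : ℂ) - (y j : ℂ) + M - 1 = ((M - 1 - (j : ℕ) : ℕ) : ℂ) := by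
    intro j
    have hj := j.isLt
    have h1 : ((M - 1 - (j : ℕ) : ℕ) : ℤ) = M - 1 - j := by omega
    have h2 : ((M - 1 - (j : ℕ) : ℕ) : ℂ) = (M : ℂ) - 1 - j := by
      exact_mod_cast congrArg (Int.cast (R := ℂ)) h1
    rw [h2, hy j, hy 0]
    push_cast
    simp
    ring
  set C : Matrix (Fin N) (Fin N) ℂ :=
    Matrix.of fun j p => (-1) ^ ((j : ℕ) - p) * (((j : ℕ).choose p : ℕ) : ℂ) with hC
  set P : Matrix (Fin N) (Fin N) ℂ :=
    Matrix.of fun p k => poissonWeight ((M - 1 - (p : ℕ) : ℕ) : ℂ) (t (Fin.rev k)) with hP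
  have hmul : (Matrix.of fun j k : Fin N => greenF (-(j : ℤ))
      ((y 0 : ℂ) - (y j : ℂ) + M - 1) (t (Fin.rev k))) = C * P := by
    ext j k
    have hj := j.isLt
    rw [Matrix.of_apply, hval, greenF_neg_natCast _
      (by simp; linarith [((M - 1 - (j : ℕ) : ℕ)).cast_nonneg (α := ℝ)])
      (Or.inr ⟨_, rfl⟩), negDiff_iterate_eq_sum, Matrix.mul_apply]
    simp only [hC, hP, Matrix.of_apply]
    rw [Fin.sum_univ_eq_sum_range (fun p =>
        (-1 : ℂ) ^ ((j : ℕ) - p) * (((j : ℕ).choose p : ℕ) : ℂ) *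
        poissonWeight ((M - 1 - p : ℕ) : ℂ) (t (Fin.rev k))) N,
      ← Finset.sum_subset (Finset.range_subset_range.2 (Nat.succ_le_of_lt hj)),
      ← Finset.sum_range_reflect]
    · refine Finset.sum_congr rfl fun l hl => ?_
      have hl' : l ≤ j := Nat.lt_succ_iff.1 (Finset.mem_range.1 hl)
      have e1 : (j : ℕ) + 1 - 1 - l = j - l := by omega
      rw [e1, Nat.choose_symm hl', ← Nat.cast_add,
        show M - 1 - (j : ℕ) + (j - l) = M - 1 - l by omega]
    · intro p _ hp
      rw [Nat.choose_eq_zero_of_lt (by simpa using hp)]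
      simp
  have hCdet : C.det = 1 := by
    rw [Matrix.det_of_isLowerTriangular]
    · simp [hC]
    · intro i j hij
      have : (i : ℕ) < j := hij
      simp [hC, Nat.choose_eq_zero_of_lt this]
  have hPdet : P.det = (∏ j : Fin N, ((M - N + (j : ℕ))! : ℂ)⁻¹) *
      ((∏ k : Fin N, (Complex.exp (-(t k : ℂ)) * (t k : ℂ) ^ (M - N))) *
        ∏ j : Fin N, ∏ k ∈ Finset.Ioi j, ((t k : ℂ) - (t j : ℂ))) := by
    rw [← Matrix.det_submatrix_equiv_self Fin.revPerm P,
      ← Matrix.det_vandermonde (fun k => (t k : ℂ)), ← Matrix.det_transpose (Matrix.vandermonde _),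
      ← Matrix.det_mul_row, ← Matrix.det_mul_column]
    congr 1
    ext p k
    have hp := p.isLt
    have e1 : M - 1 - (Fin.rev p : ℕ) = M - N + p := by
      rw [Fin.val_rev]; omega
    simp only [hP, Matrix.submatrix_apply, Matrix.of_apply, Fin.revPerm_apply, Fin.rev_rev,
      Matrix.transpose_apply, Matrix.vandermonde_apply]
    rw [e1, poissonWeight_natCast, pow_add]
    ring
  rw [hopIntegrand, hmul, Matrix.det_mul, hCdet, hPdet, one_mul, Finset.prod_inv_distrib]
  push_cast
  simp_rw [Finset.prod_pow, Finset.prod_mul_distrib]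
  ring

lemma hopIntegral_step {N : ℕ} [NeZero N] {y : Fin N → ℤ}
    (hy : ∀ j : Fin N, y j = -(N : ℤ) + ((j : ℤ) + 1)) {M : ℕ} (hM : N ≤ M) (T : ℝ) :
    hopIntegral y T M = (laguerreIntegral N M T : ℂ) := by
  rw [hopIntegral, laguerreIntegral, funext (hopIntegrand_step hy hM), integral_const_mul,
    integral_complex_ofReal]
  push_cast
  rw [Finset.prod_mul_distrib, one_div, one_div, mul_inv]
  ring

/-! ### The generator and its iterates -/

lemma tasepGenerator_sub {N : ℕ} (f g : (Fin N → ℤ) → ℝ) (x : Fin N → ℤ) :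
    tasepGenerator (fun z => f z - g z) x = tasepGenerator f x - tasepGenerator g x := by
  simp only [tasepGenerator, ← Finset.sum_sub_distrib]
  refine Finset.sum_congr rfl fun j _ => ?_
  split_ifs <;> ring

lemma tasepGenerator_sum {N : ℕ} {ι : Type*} (s : Finset ι) (c : ι → ℝ)
    (f : ι → (Fin N → ℤ) → ℝ) (x : Fin N → ℤ) :
    tasepGenerator (fun z => ∑ k ∈ s, c k * f k z) x = ∑ k ∈ s, c k * tasepGenerator (f k) x := by
  simp only [tasepGenerator, Finset.mul_sum]
  rw [Finset.sum_comm]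
  refine Finset.sum_congr rfl fun j _ => ?_
  split_ifs
  · rw [← Finset.sum_sub_distrib]
    exact Finset.sum_congr rfl fun k _ => by ring
  · simp

lemma strictMono_update_of_empty {N : ℕ} {x : Fin N → ℤ} (hx : StrictMono x) {j : Fin N}
    (hj : ∀ k, x k ≠ x j + 1) : StrictMono (Function.update x j (x j + 1)) := by
  intro a b hab
  have h := hx hab
  by_cases ha : a = j
  · subst ha
    rw [Function.update_self, Function.update_of_ne hab.ne']
    have := hj b
    omega
  · rw [Function.update_of_ne ha]
    by_cases hb : b = j
    · subst hb
      rw [Function.update_self]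
      omega
    · rwa [Function.update_of_ne hb]

/-- Allowed hops keep the particles ordered, so values at unordered configurations never enter. -/
lemma tasepGenerator_congr {N : ℕ} {f g : (Fin N → ℤ) → ℝ}
    (h : ∀ x, StrictMono x → f x = g x) {x : Fin N → ℤ} (hx : StrictMono x) :
    tasepGenerator f x = tasepGenerator g x := by
  refine Finset.sum_congr rfl fun j _ => ?_
  split_ifs with hj
  · rw [h x hx, h _ (strictMono_update_of_empty hx hj)]
  · rfl

/-- The generator is bounded by `2N` on functions of ordered configurations. -/
lemma abs_tasepGenerator_le {N : ℕ} {f : (Fin N → ℤ) → ℝ} {C : ℝ}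
    (hf : ∀ x, StrictMono x → |f x| ≤ C) {x : Fin N → ℤ} (hx : StrictMono x) :
    |tasepGenerator f x| ≤ 2 * N * C := by
  have hC : 0 ≤ C := (abs_nonneg _).trans (hf x hx)
  calc |tasepGenerator f x| ≤ ∑ j : Fin N, 2 * C := by
        refine (Finset.abs_sum_le_sum_abs _ _).trans (Finset.sum_le_sum fun j _ => ?_)
        split_ifs with h
        · have h1 := hf _ (strictMono_update_of_empty hx h)
          have h2 := hf _ hx
          exact (abs_sub _ _).trans (by linarith)
        · simpa using hC
    _ = 2 * N * C := by simp; ring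

/-- The generator is bounded by `2N` on functions of all configurations. -/
lemma abs_tasepGenerator_le_of_forall {N : ℕ} {f : (Fin N → ℤ) → ℝ} {C : ℝ}
    (hf : ∀ x, |f x| ≤ C) (x : Fin N → ℤ) : |tasepGenerator f x| ≤ 2 * N * C := by
  have hC : 0 ≤ C := (abs_nonneg _).trans (hf x)
  calc |tasepGenerator f x| ≤ ∑ j : Fin N, 2 * C := by
        refine (Finset.abs_sum_le_sum_abs _ _).trans (Finset.sum_le_sum fun j _ => ?_)
        split_ifs with h
        · exact (abs_sub _ _).trans (by linarith [hf x, hf (Function.update x j (x j + 1))])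
        · simpa using hC
    _ = 2 * N * C := by simp; ring

/-- Partial sums of the exponential series of the generator. -/
def tasepTaylor {N : ℕ} (n : ℕ) (f : (Fin N → ℤ) → ℝ) (t : ℝ) (x : Fin N → ℤ) : ℝ :=
  ∑ k ∈ Finset.range n, t ^ k / (k ! : ℝ) * tasepGenerator^[k] f x

lemma continuous_tasepTaylor {N : ℕ} (n : ℕ) (f : (Fin N → ℤ) → ℝ) (x : Fin N → ℤ) :
    Continuous fun t => tasepTaylor n f t x := by
  unfold tasepTaylor
  fun_prop

lemma tasepTaylor_succ {N : ℕ} (n : ℕ) (f : (Fin N → ℤ) → ℝ) (t : ℝ) (x : Fin N → ℤ) :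
    tasepTaylor (n + 1) f t x = f x + ∫ s in (0 : ℝ)..t, tasepTaylor n (tasepGenerator f) s x := by
  unfold tasepTaylor
  rw [intervalIntegral.integral_finsetSum
    (fun k _ => Continuous.intervalIntegrable (by fun_prop) _ _), Finset.sum_range_succ']
  simp only [pow_zero, Nat.factorial_zero, Nat.cast_one, div_one, one_mul, Function.iterate_zero,
    id_eq]
  rw [add_comm]
  congr 1
  refine Finset.sum_congr rfl fun k _ => ?_
  rw [intervalIntegral.integral_mul_const, intervalIntegral.integral_div, integral_pow,
    Function.iterate_succ_apply, Nat.factorial_succ]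
  congr 1
  push_cast
  have : (k ! : ℝ) ≠ 0 := by exact_mod_cast Nat.factorial_ne_zero k
  field_simp
  simp

lemma tasepGenerator_tasepTaylor {N : ℕ} (n : ℕ) (f : (Fin N → ℤ) → ℝ) (t : ℝ) (x : Fin N → ℤ) :
    tasepGenerator (tasepTaylor n f t) x = tasepTaylor n (tasepGenerator f) t x := by
  unfold tasepTaylor
  rw [tasepGenerator_sum]
  refine Finset.sum_congr rfl fun k _ => ?_
  rw [← Function.iterate_succ_apply' tasepGenerator, Function.iterate_succ_apply]

lemma abs_integral_le_of_abs_le_pow {g : ℝ → ℝ} {t K : ℝ} (n : ℕ) (ht : 0 ≤ t)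
    (hg : ∀ s ∈ Set.Icc 0 t, |g s| ≤ K * (s ^ n / (n ! : ℝ))) :
    |∫ s in (0 : ℝ)..t, g s| ≤ K * (t ^ (n + 1) / ((n + 1)! : ℝ)) := by
  have h1 : ∫ s in (0 : ℝ)..t, K * (s ^ n / (n ! : ℝ)) = K * (t ^ (n + 1) / ((n + 1)! : ℝ)) := by
    rw [intervalIntegral.integral_const_mul, intervalIntegral.integral_div, integral_pow,
      Nat.factorial_succ]
    push_cast
    have : (n ! : ℝ) ≠ 0 := by exact_mod_cast Nat.factorial_ne_zero n
    field_simp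
    simp
  rw [← h1]
  exact intervalIntegral.norm_integral_le_of_norm_le (f := g)
    (g := fun s => K * (s ^ n / (n ! : ℝ))) ht
    (ae_of_all _ fun s hs => hg s ⟨hs.1.le, hs.2⟩)
    (Continuous.intervalIntegrable (by fun_prop) _ _)

/-- A bounded solution of the backward equation is given by the exponential series. -/
lemma abs_sub_tasepTaylor_le {N : ℕ} {u : ℝ → (Fin N → ℤ) → ℝ} {T C : ℝ}
    (hC : ∀ t ∈ Set.Icc 0 T, ∀ x, StrictMono x → |u t x| ≤ C)
    (hc : ∀ x, StrictMono x → ContinuousOn (fun t => u t x) (Set.Icc 0 T))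
    (hd : ∀ x, StrictMono x → ∀ t ∈ Set.Ioo 0 T,
      HasDerivAt (fun t => u t x) (tasepGenerator (u t) x) t) (n : ℕ) :
    ∀ t ∈ Set.Icc 0 T, ∀ x, StrictMono x →
      |u t x - tasepTaylor n (u 0) t x| ≤ C * (2 * N) ^ n * (t ^ n / (n ! : ℝ)) := by
  induction n with
  | zero => intro t ht x hx; simpa [tasepTaylor] using hC t ht x hx
  | succ n ih =>
    intro t ht x hx
    have hsub : Set.Icc 0 t ⊆ Set.Icc 0 T := Set.Icc_subset_Icc_right ht.2
    have hL : ContinuousOn (fun s => tasepGenerator (u s) x) (Set.Icc 0 T) := by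
      unfold tasepGenerator
      refine continuousOn_finsetSum _ fun j _ => ?_
      split_ifs with h
      · exact (hc _ (strictMono_update_of_empty hx h)).sub (hc x hx)
      · exact continuousOn_const
    have hLi : IntervalIntegrable (fun s => tasepGenerator (u s) x) volume 0 t := by
      apply ContinuousOn.intervalIntegrable
      rw [Set.uIcc_of_le ht.1]
      exact hL.mono hsub
    have h1 : u t x = u 0 x + ∫ s in (0 : ℝ)..t, tasepGenerator (u s) x := by
      rw [intervalIntegral.integral_eq_sub_of_hasDeriv_right_of_le ht.1 ((hc x hx).mono hsub)
        (fun s hs => (hd x hx s ⟨hs.1, hs.2.trans_le ht.2⟩).hasDerivWithinAt) hLi]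
      ring
    rw [h1, tasepTaylor_succ, add_sub_add_left_eq_sub, ← intervalIntegral.integral_sub hLi
      ((continuous_tasepTaylor n _ x).intervalIntegrable _ _)]
    -- The error of order `n + 1` is the time integral of the generator applied to the error of
    -- order `n`: the generator costs `2N`, and the integration raises the power of time.
    refine (abs_integral_le_of_abs_le_pow (K := C * (2 * N) ^ (n + 1)) n ht.1 fun s hs => ?_)
    rw [← tasepGenerator_tasepTaylor, ← tasepGenerator_sub]
    refine (abs_tasepGenerator_le (C := C * (2 * N) ^ n * (s ^ n / (n ! : ℝ)))
      (fun z hz => ih s (hsub hs) z hz) hx).trans (le_of_eq ?_)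
    rw [pow_succ]
    ring

/-! ### The law of the process -/

/-- Every time is a limit from the right of measurably chosen rational times. -/
lemma exists_nat_seq_tendsto_from_right :
    ∃ r : ℕ → ℝ → ℕ, (∀ n, Measurable (r n)) ∧ ∀ s : ℝ,
      Tendsto (fun n => ((r n s : ℝ≥0) + 1) / (n + 1)) atTop
        (𝓝[Set.Ici s.toNNReal] s.toNNReal) := by
  -- Adding one to the floor puts the grid point of mesh `1 / (n + 1)` to the right of `s`, at
  -- distance at most one mesh.
  refine ⟨fun n s => ⌊(n + 1 : ℝ) * s.toNNReal⌋₊,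
    fun n => Nat.measurable_floor.comp (by fun_prop), fun s => ?_⟩
  have h1 : ∀ n : ℕ, s.toNNReal ≤ ((⌊(n + 1 : ℝ) * s.toNNReal⌋₊ : ℝ≥0) + 1) / (n + 1) := by
    intro n
    rw [← NNReal.coe_le_coe]
    simp only [NNReal.coe_div, NNReal.coe_add, NNReal.coe_natCast, NNReal.coe_one]
    rw [le_div_iff₀ (by positivity)]
    have := Nat.lt_floor_add_one ((n + 1 : ℝ) * s.toNNReal)
    linarith
  have h2 : ∀ n : ℕ, ((((⌊(n + 1 : ℝ) * s.toNNReal⌋₊ : ℝ≥0) + 1) / (n + 1) : ℝ≥0) : ℝ) ≤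
      s.toNNReal + 1 / (n + 1) := by
    intro n
    simp only [NNReal.coe_div, NNReal.coe_add, NNReal.coe_natCast, NNReal.coe_one]
    rw [add_div]
    have := Nat.floor_le (a := (n + 1 : ℝ) * s.toNNReal) (by positivity)
    gcongr
    rw [div_le_iff₀ (by positivity)]
    linarith
  refine tendsto_nhdsWithin_iff.2 ⟨?_, Eventually.of_forall h1⟩
  rw [← NNReal.tendsto_coe]
  refine tendsto_of_tendsto_of_tendsto_of_le_of_le tendsto_const_nhds ?_
    (fun n => NNReal.coe_le_coe.2 (h1 n)) h2
  simpa using (tendsto_const_nhds (x := (s.toNNReal : ℝ))).add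
    (tendsto_one_div_add_atTop_nhds_zero_nat (𝕜 := ℝ))

section Law

variable {Ω : Type*} {mΩ : MeasurableSpace Ω} {μ : Measure Ω}
  {ℱ : Filtration ℝ≥0 mΩ} {N : ℕ} {y : Fin N → ℤ} {X : ℝ≥0 → Ω → Fin N → ℤ}

lemma IsTASEP.measurable (hX : IsTASEP μ ℱ y X) (t : ℝ≥0) : Measurable (X t) :=
  (hX.adapted t).mono (ℱ.le t) le_rfl

/-- Right continuity makes the process a pointwise limit of processes sampled on countable time
grids. Joint measurability is what Fubini needs in the forward equation. -/
lemma IsTASEP.measurable_uncurry (hX : IsTASEP μ ℱ y X) :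
    Measurable fun p : ℝ × Ω => X p.1.toNNReal p.2 := by
  obtain ⟨r, hr, hlim⟩ := exists_nat_seq_tendsto_from_right
  have hmeas : ∀ n : ℕ, Measurable fun p : ℝ × Ω => X (((r n p.1 : ℝ≥0) + 1) / (n + 1)) p.2 := by
    intro n
    have hq : ∀ Y : ℕ → Ω → Fin N → ℤ, (∀ k, Measurable (Y k)) →
        Measurable fun p : ℝ × Ω => Y (r n p.1) p.2 := fun Y hY =>
      (measurable_from_prod_countable_right (f := fun q : ℕ × Ω => Y q.1 q.2) hY).comp
        (((hr n).comp measurable_fst).prodMk measurable_snd)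
    exact hq (fun k => X (((k : ℝ≥0) + 1) / (n + 1))) fun k => hX.measurable _
  have hconv : ∀ p : ℝ × Ω, Tendsto (fun n : ℕ => X (((r n p.1 : ℝ≥0) + 1) / (n + 1)) p.2) atTop
      (𝓝 (X p.1.toNNReal p.2)) := by
    intro p
    have h := hX.right_continuous p.2 p.1.toNNReal
    rw [ContinuousWithinAt] at h
    exact h.comp (hlim p.1)
  exact measurable_of_tendsto_metrizable hmeas (tendsto_pi_nhds.2 hconv)

variable [IsProbabilityMeasure μ]

lemma IsTASEP.integrable_uncurry (hX : IsTASEP μ ℱ y X) {f : (Fin N → ℤ) → ℝ} {C : ℝ}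
    (hf : ∀ x, |f x| ≤ C) (t : ℝ) :
    Integrable (fun p : ℝ × Ω => f (X p.1.toNNReal p.2))
      ((volume.restrict (Set.uIoc 0 t)).prod μ) := by
  have : IsFiniteMeasure (volume.restrict (Set.uIoc 0 t)) := by
    unfold Set.uIoc
    infer_instance
  refine Integrable.of_bound (C := C) ?_ (ae_of_all _ fun p => hf _)
  exact ((measurable_of_countable f).comp hX.measurable_uncurry).aestronglyMeasurable

/-- Kolmogorov's forward equation, integrated in time. -/
lemma IsTASEP.integral_eq (hX : IsTASEP μ ℱ y X) {f : (Fin N → ℤ) → ℝ} {C : ℝ}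
    (hf : ∀ x, |f x| ≤ C) (t : ℝ≥0) :
    ∫ ω, f (X t ω) ∂μ = f y + ∫ s in (0 : ℝ)..t, ∫ ω, tasepGenerator f (X s.toNNReal ω) ∂μ := by
  have hm := hX.martingale f ⟨C, hf⟩
  have h1 := hm.setIntegral_eq (zero_le (a := t)) (MeasurableSet.univ)
  simp only [Measure.restrict_univ] at h1
  have hi : Integrable (fun ω => f (X t ω)) μ :=
    Integrable.of_bound (C := C) (((measurable_of_countable f).comp
      (hX.measurable t)).aestronglyMeasurable) (ae_of_all _ fun p => hf _)
  have hprod := hX.integrable_uncurry (f := tasepGenerator f)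
    (abs_tasepGenerator_le_of_forall hf) t
  have hi2 : Integrable (fun ω => ∫ s in (0 : ℝ)..t, tasepGenerator f (X s.toNNReal ω)) μ := by
    refine (hi.sub (hm.integrable t)).congr (ae_of_all _ fun ω => ?_)
    simp only [Pi.sub_apply, sub_sub_cancel]
  rw [integral_sub hi hi2] at h1
  have h0 : ∫ ω, (f (X 0 ω) - ∫ s in (0 : ℝ)..((0 : ℝ≥0) : ℝ),
      tasepGenerator f (X s.toNNReal ω)) ∂μ = f y := by
    have : (fun ω => f (X 0 ω) - ∫ s in (0 : ℝ)..((0 : ℝ≥0) : ℝ),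
        tasepGenerator f (X s.toNNReal ω)) =ᵐ[μ] fun _ => f y := by
      filter_upwards [hX.initial] with ω hω
      simp [hω]
    rw [integral_congr_ae this]
    simp
  rw [h0] at h1
  rw [intervalIntegral_integral_swap hprod]
  linarith

lemma IsTASEP.intervalIntegrable (hX : IsTASEP μ ℱ y X) {f : (Fin N → ℤ) → ℝ} {C : ℝ}
    (hf : ∀ x, |f x| ≤ C) (t : ℝ) :
    IntervalIntegrable (fun s => ∫ ω, f (X s.toNNReal ω) ∂μ) volume 0 t := by
  rw [intervalIntegrable_iff]
  exact (hX.integrable_uncurry hf t).integral_prod_left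

/-- Iteration of the forward equation, with `f` replaced by its image under the generator at each
stage; the bound is the one for the backward equation. -/
lemma IsTASEP.abs_integral_sub_tasepTaylor_le (hX : IsTASEP μ ℱ y X) (n : ℕ) :
    ∀ (f : (Fin N → ℤ) → ℝ) (C : ℝ), (∀ x, |f x| ≤ C) → ∀ t : ℝ≥0,
      |∫ ω, f (X t ω) ∂μ - tasepTaylor n f t y| ≤ C * (2 * N) ^ n * ((t : ℝ) ^ n / (n ! : ℝ)) := by
  induction n with
  | zero =>
    intro f C hf t
    have := norm_integral_le_of_norm_le_const (μ := μ) (f := fun ω => f (X t ω)) (C := C)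
      (ae_of_all _ fun ω => hf _)
    simpa [tasepTaylor] using this
  | succ n ih =>
    intro f C hf t
    have hLf := abs_tasepGenerator_le_of_forall hf
    rw [hX.integral_eq hf, tasepTaylor_succ, add_sub_add_left_eq_sub,
      ← intervalIntegral.integral_sub (hX.intervalIntegrable hLf t)
        ((continuous_tasepTaylor n _ y).intervalIntegrable _ _)]
    refine (abs_integral_le_of_abs_le_pow (K := C * (2 * N) ^ (n + 1)) n t.2 fun s hs => ?_)
    have h := ih (tasepGenerator f) (2 * N * C) hLf s.toNNReal
    rw [Real.coe_toNNReal s hs.1] at h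
    refine h.trans (le_of_eq ?_)
    rw [pow_succ]
    ring

/-- A bounded solution of the backward equation gives the expectations of the process. -/
lemma IsTASEP.integral_eq_of_backward (hX : IsTASEP μ ℱ y X) (hy : StrictMono y) {T : ℝ≥0}
    {u : ℝ → (Fin N → ℤ) → ℝ} {f : (Fin N → ℤ) → ℝ} {B C : ℝ} (hf : ∀ x, |f x| ≤ B)
    (hf0 : ∀ x, StrictMono x → u 0 x = f x)
    (hC : ∀ t ∈ Set.Icc (0 : ℝ) T, ∀ x, StrictMono x → |u t x| ≤ C)
    (hc : ∀ x, StrictMono x → ContinuousOn (fun t => u t x) (Set.Icc (0 : ℝ) T))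
    (hd : ∀ x, StrictMono x → ∀ t ∈ Set.Ioo (0 : ℝ) T,
      HasDerivAt (fun t => u t x) (tasepGenerator (u t) x) t) :
    ∫ ω, f (X T ω) ∂μ = u T y := by
  have hiter : ∀ k x, StrictMono x → tasepGenerator^[k] (u 0) x = tasepGenerator^[k] f x := by
    intro k
    induction k with
    | zero => exact hf0
    | succ k ih =>
      intro x hx
      rw [Function.iterate_succ_apply', Function.iterate_succ_apply']
      exact tasepGenerator_congr ih hx
  have hT : (T : ℝ) ∈ Set.Icc (0 : ℝ) T := ⟨T.2, le_rfl⟩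
  have hb : ∀ n : ℕ, |∫ ω, f (X T ω) ∂μ - u T y| ≤
      (B + C) * ((2 * N * (T : ℝ)) ^ n / (n ! : ℝ)) := by
    intro n
    have h1 := hX.abs_integral_sub_tasepTaylor_le n f B hf T
    have h2 := abs_sub_tasepTaylor_le hC hc hd n T hT y hy
    have h3 : tasepTaylor n (u 0) T y = tasepTaylor n f T y :=
      Finset.sum_congr rfl fun k _ => by rw [hiter k y hy]
    rw [h3] at h2
    rw [abs_sub_comm] at h2
    calc _ ≤ _ := abs_sub_le _ (tasepTaylor n f T y) _
      _ ≤ _ := add_le_add h1 h2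
      _ = _ := by rw [mul_pow]; ring
  have hlim := (FloorSemiring.tendsto_pow_div_factorial_atTop (2 * N * (T : ℝ))).const_mul (B + C)
  rw [mul_zero] at hlim
  have := ge_of_tendsto' hlim hb
  exact sub_eq_zero.1 (abs_eq_zero.1 (le_antisymm this (abs_nonneg _)))

end Law

/-! ### Entries of the determinant at integer arguments -/

/-- The entry `(j, i)` of the determinant, with the argument shifted by the row index. -/
def rowEntry (j i : ℕ) (m : ℤ) (t : ℝ) : ℂ := tailEntry j i ((m : ℂ) - j) t

lemma tailEntry_succ_left (j i : ℕ) (z : ℂ) (t : ℝ) :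
    tailEntry (j + 1) i z t = tailEntry j i z t - tailEntry j i (z + 1) t := by
  rw [tailEntry, Function.iterate_succ_apply']
  rfl

lemma negDiff_iterate_shift (j : ℕ) (h : ℂ → ℂ) (z : ℂ) :
    negDiff^[j] (fun m => h (m + 1)) z = negDiff^[j] h (z + 1) := by
  simp_rw [negDiff_iterate_eq_sum]
  exact Finset.sum_congr rfl fun l _ => by rw [add_right_comm]

lemma tailEntry_succ_succ (j i : ℕ) (z : ℂ) {t : ℝ} (ht : 0 ≤ t) :
    tailEntry (j + 1) (i + 1) z t = tailEntry j i (z + 1) t := by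
  rw [tailEntry, Function.iterate_succ_apply, tailEntry, ← negDiff_iterate_shift]
  have h : negDiff (fun m => poissonTail (i + 1) m t) = fun m => poissonTail i (m + 1) t :=
    funext fun m => poissonTail_succ_sub i m ht
  rw [h]

lemma hasDerivAt_tailEntry (j i : ℕ) (z : ℂ) {t : ℝ} (ht : 0 < t) :
    HasDerivAt (tailEntry j i z) (tailEntry (j + 1) i (z - 1) t) t := by
  have h : HasDerivAt (fun t => ∑ l ∈ Finset.range (j + 1),
      (-1) ^ l * (j.choose l : ℂ) * poissonTail i (z + l) t)
      (∑ l ∈ Finset.range (j + 1), (-1) ^ l * (j.choose l : ℂ) *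
        (poissonTail i (z + l - 1) t - poissonTail i (z + l) t)) t :=
    HasDerivAt.fun_sum fun l _ => (hasDerivAt_poissonTail i (z + l) ht).const_mul _
  rw [show tailEntry j i z = fun t => ∑ l ∈ Finset.range (j + 1),
      (-1) ^ l * (j.choose l : ℂ) * poissonTail i (z + l) t from
    funext fun t => tailEntry_eq_sum j i z t]
  refine h.congr_deriv ?_
  rw [tailEntry_succ_left, tailEntry_eq_sum, tailEntry_eq_sum, sub_add_cancel,
    ← Finset.sum_sub_distrib]
  exact Finset.sum_congr rfl fun l _ => by rw [mul_sub, add_sub_right_comm]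

/-- The shift by the row index is chosen so that differentiation moves to the next row without
changing `m`. -/
lemma hasDerivAt_rowEntry (j i : ℕ) (m : ℤ) {t : ℝ} (ht : 0 < t) :
    HasDerivAt (rowEntry j i m) (rowEntry (j + 1) i m t) t := by
  refine (hasDerivAt_tailEntry j i ((m : ℂ) - j) ht).congr_deriv ?_
  rw [rowEntry]
  congr 1
  push_cast
  ring

lemma rowEntry_succ_left (j i : ℕ) (m : ℤ) (t : ℝ) :
    rowEntry (j + 1) i m t = rowEntry j i (m - 1) t - rowEntry j i m t := by
  rw [rowEntry, tailEntry_succ_left, rowEntry, rowEntry]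
  congr 2 <;> · push_cast; ring

lemma rowEntry_add_add (j i k : ℕ) (m : ℤ) {t : ℝ} (ht : 0 ≤ t) :
    rowEntry (j + k) (i + k) m t = rowEntry j i m t := by
  induction k with
  | zero => rfl
  | succ k ih =>
    rw [← ih, rowEntry, ← add_assoc, ← add_assoc, tailEntry_succ_succ _ _ _ ht, rowEntry]
    congr 1
    push_cast
    ring

lemma rowEntry_self_of_nonpos (j : ℕ) {m : ℤ} (hm : m ≤ 0) {t : ℝ} (ht : 0 ≤ t) :
    rowEntry j j m t = 1 := by
  have h := rowEntry_add_add 0 0 j m ht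
  rw [zero_add] at h
  rw [h, rowEntry, tailEntry]
  simpa using poissonTail_zero_of_nonpos hm ht

/-- There are more differences than needed to undo all summations, so only single weights remain,
and all their indices are negative. -/
lemma rowEntry_of_lt_of_nonpos {j i : ℕ} (hij : i < j) {m : ℤ} (hm : m ≤ 0) {t : ℝ} (ht : 0 ≤ t) :
    rowEntry j i m t = 0 := by
  obtain ⟨d, rfl⟩ := Nat.exists_eq_add_of_lt hij
  have h := rowEntry_add_add (d + 1) 0 i m ht
  rw [zero_add] at h
  rw [show i + d + 1 = d + 1 + i by ring, h, rowEntry, tailEntry, Function.iterate_succ_apply,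
    show negDiff (fun m => poissonTail 0 m t) = fun m => poissonWeight m t from
      funext fun m => poissonTail_zero_sub m ht, negDiff_iterate_eq_sum]
  refine Finset.sum_eq_zero fun l hl => ?_
  have hl' := Finset.mem_range.1 hl
  have : (m : ℂ) - ((d + 1 : ℕ) : ℂ) + l = ((m - (d + 1 : ℕ) + l : ℤ) : ℂ) := by push_cast; ring
  rw [this, poissonWeight_of_neg (by push_cast; omega), mul_zero]

lemma rowEntry_zero_left_zero_right (i : ℕ) {m : ℤ} (hm : 0 < m) : rowEntry 0 i m 0 = 0 := by
  rw [rowEntry, tailEntry]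
  have : 0 < (m : ℂ).re := by rw [Complex.intCast_re]; exact_mod_cast hm
  simpa using poissonTail_zero_right i this

lemma rowEntry_eq_sum (j i : ℕ) (m : ℤ) (t : ℝ) : rowEntry j i m t =
    ∑ l ∈ Finset.range (j + 1), (-1) ^ l * (j.choose l : ℂ) *
      poissonTail i ((m - j + l : ℤ) : ℂ) t := by
  rw [rowEntry, tailEntry_eq_sum]
  push_cast
  rfl

lemma continuousOn_rowEntry (j i : ℕ) (m : ℤ) : ContinuousOn (rowEntry j i m) (Set.Ici 0) := by
  rw [funext (rowEntry_eq_sum j i m)]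
  exact continuousOn_finsetSum _ fun l _ =>
    continuousOn_const.mul (continuousOn_poissonTail_intCast i _)

/-- The indices that occur are at least `-j`. This uniform bound is the reason for the cutoff at
zero in `sitesToGo`. -/
lemma exists_norm_rowEntry_le (j i : ℕ) {T : ℝ} (hT : 0 ≤ T) :
    ∃ C, ∀ m : ℤ, 0 ≤ m → ∀ t ∈ Set.Icc 0 T, ‖rowEntry j i m t‖ ≤ C := by
  obtain ⟨B, hB⟩ := exists_norm_poissonTail_intCast_le i j hT
  refine ⟨∑ l ∈ Finset.range (j + 1), (j.choose l : ℝ) * B, fun m hm t ht => ?_⟩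
  rw [rowEntry_eq_sum]
  refine (norm_sum_le _ _).trans (Finset.sum_le_sum fun l _ => ?_)
  rw [norm_mul, norm_mul, norm_pow, norm_neg, norm_one, one_pow, one_mul, Complex.norm_natCast]
  gcongr
  exact hB _ (by omega) t ht

/-! ### The determinantal solution of the backward equation -/

lemma hasDerivAt_det {n : Type*} [Fintype n] [DecidableEq n] {A : ℝ → Matrix n n ℂ}
    {A' : Matrix n n ℂ} {t : ℝ} (h : ∀ i j, HasDerivAt (fun s => A s i j) (A' i j) t) :
    HasDerivAt (fun s => (A s).det) (∑ i, ((A t).updateRow i (A' i)).det) t := by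
  have h1 : HasDerivAt (fun s => (A s).transpose.det)
      (∑ σ : Equiv.Perm n, ((Equiv.Perm.sign σ : ℤ) : ℂ) *
      ∑ i, (∏ k ∈ Finset.univ.erase i, A t k (σ k)) • A' i (σ i)) t := by
    simp_rw [Matrix.det_apply', Matrix.transpose_apply]
    exact HasDerivAt.fun_sum fun σ _ =>
      (HasDerivAt.fun_finsetProd fun i _ => h i (σ i)).const_mul _
  simp_rw [Matrix.det_transpose] at h1
  refine h1.congr_deriv ?_
  simp_rw [Finset.mul_sum]
  rw [Finset.sum_comm]
  refine Finset.sum_congr rfl fun i _ => ?_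
  rw [← Matrix.det_transpose, Matrix.det_apply']
  refine Finset.sum_congr rfl fun σ _ => ?_
  congr 1
  simp_rw [Matrix.transpose_apply]
  rw [← Finset.mul_prod_erase Finset.univ _ (Finset.mem_univ i), Matrix.updateRow_self,
    smul_eq_mul, mul_comm]
  congr 1
  refine Finset.prod_congr rfl fun k hk => ?_
  rw [Matrix.updateRow_ne (Finset.ne_of_mem_erase hk)]

lemma StrictMono.add_val_sub_le {N : ℕ} {x : Fin N → ℤ} (hx : StrictMono x) {i j : Fin N}
    (hij : i ≤ j) : x i + ((j : ℤ) - i) ≤ x j := by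
  obtain ⟨d, hd⟩ := Nat.exists_eq_add_of_le (Fin.le_def.1 hij)
  induction d generalizing j with
  | zero =>
    have : j = i := Fin.ext (by omega)
    subst this
    simp
  | succ d ih =>
    have hlt : (i : ℕ) + d < N := by have := j.isLt; omega
    have h1 := ih (j := ⟨(i : ℕ) + d, hlt⟩) (Fin.le_def.2 (by simp)) rfl
    have h2 : x ⟨(i : ℕ) + d, hlt⟩ < x j := hx (Fin.lt_def.2 (by simp only; omega))
    simp only at h1
    push_cast at h1 hd
    omega

/-- The matrix with rows `rowEntry j · (κ j) t`. -/
def hopMatrix {N : ℕ} (κ : Fin N → ℤ) (t : ℝ) : Matrix (Fin N) (Fin N) ℂ :=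
  Matrix.of fun j i => rowEntry j i (κ j) t

/-- The number of sites that particle `j` has to advance in order to reach `a + j`. -/
def sitesToGo {N : ℕ} (a : ℤ) (x : Fin N → ℤ) (j : Fin N) : ℤ := max (a - x j + j) 0

/-- The exclusion rule in determinantal form: differentiating row `j` duplicates the next row when
both have the same argument. -/
lemma det_updateRow_eq_zero_of_eq {N : ℕ} {κ : Fin N → ℤ} (t : ℝ) {j k : Fin N}
    (hjk : (k : ℕ) = j + 1) (h : κ k = κ j) :
    ((hopMatrix κ t).updateRow j fun i => rowEntry (j + 1) i (κ j) t).det = 0 := by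
  have hne : j ≠ k := by
    intro h; rw [h] at hjk; omega
  refine Matrix.det_zero_of_row_eq hne ?_
  ext i
  rw [Matrix.updateRow_self, Matrix.updateRow_ne hne.symm, hopMatrix, Matrix.of_apply, h, hjk]

lemma det_updateRow_sub {N : ℕ} (κ : Fin N → ℤ) (t : ℝ) (j : Fin N) :
    ((hopMatrix κ t).updateRow j fun i => rowEntry (j + 1) i (κ j) t).det =
      (hopMatrix (Function.update κ j (κ j - 1)) t).det - (hopMatrix κ t).det := by
  have h1 : hopMatrix (Function.update κ j (κ j - 1)) t =
      (hopMatrix κ t).updateRow j fun i => rowEntry j i (κ j - 1) t := by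
    ext k i
    by_cases hk : k = j
    · subst hk
      simp [hopMatrix, Matrix.updateRow_self]
    · simp [hopMatrix, Matrix.updateRow_ne hk, Function.update_of_ne hk]
  have h2 : (fun i : Fin N => rowEntry j i (κ j - 1) t) =
      (fun i : Fin N => rowEntry (j + 1) i (κ j) t) + (hopMatrix κ t) j := by
    ext i
    simp [hopMatrix, rowEntry_succ_left]
  rw [h1, h2, Matrix.det_updateRow_add, Matrix.updateRow_eq_self]
  ring

/-- Each row contributes to the time derivative of the determinant as the hop of the corresponding
particle contributes to the generator. -/
lemma det_updateRow_sitesToGo {N : ℕ} (a : ℤ) {x : Fin N → ℤ} (hx : StrictMono x) {t : ℝ}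
    (ht : 0 ≤ t) (j : Fin N) :
    ((hopMatrix (sitesToGo a x) t).updateRow j
      fun i => rowEntry (j + 1) i (sitesToGo a x j) t).det =
    if ∀ k, x k ≠ x j + 1 then
      (hopMatrix (sitesToGo a (Function.update x j (x j + 1))) t).det -
        (hopMatrix (sitesToGo a x) t).det
    else 0 := by
  have hupd : ∀ c : ℤ, max (a - (x j + 1) + j) 0 = c →
      sitesToGo a (Function.update x j (x j + 1)) = Function.update (sitesToGo a x) j c := by
    intro c hc
    ext k
    by_cases hk : k = j
    · subst hk
      simp [sitesToGo, hc]
    · simp [sitesToGo, Function.update_of_ne hk]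
  split_ifs with hfree
  · rcases le_or_gt (a - x j + j) 0 with h0 | h0
    -- The particle is already far enough, so its hop changes nothing; the particles to its right
    -- are far enough too, and row `j + 1` also has argument zero.
    · have hκ : sitesToGo a x j = 0 := max_eq_right h0
      rw [hupd (sitesToGo a x j) (by rw [hκ]; exact max_eq_right (by linarith)),
        Function.update_eq_self, sub_self]
      by_cases hj : (j : ℕ) + 1 < N
      · refine det_updateRow_eq_zero_of_eq t (k := ⟨j + 1, hj⟩) rfl ?_
        have := hx.add_val_sub_le (i := j) (j := ⟨j + 1, hj⟩) (Fin.le_def.2 (by simp))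
        rw [hκ]
        refine max_eq_right ?_
        push_cast at this ⊢
        linarith
      -- For the last particle the differentiated row has index `N`, beyond every column, and
      -- vanishes at argument zero.
      · refine Matrix.det_eq_zero_of_row_eq_zero j fun i => ?_
        rw [Matrix.updateRow_self, hκ]
        exact rowEntry_of_lt_of_nonpos (by have := i.isLt; omega) le_rfl ht
    · have hκ : sitesToGo a x j = a - x j + j := max_eq_left h0.le
      rw [hupd (sitesToGo a x j - 1) (by rw [hκ, max_eq_left (by linarith)]; ring)]
      exact det_updateRow_sub _ t j
  -- The blocking particle must be `j + 1`, and adjacency of the two sites makes the arguments of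
  -- both rows equal.
  · push Not at hfree
    obtain ⟨k, hk⟩ := hfree
    have hjk : j < k := hx.lt_iff_lt.1 (by omega)
    have h1 := hx.add_val_sub_le hjk.le
    have hjk' := Fin.lt_def.1 hjk
    have h2 : (k : ℕ) = j + 1 := by omega
    refine det_updateRow_eq_zero_of_eq t h2 ?_
    unfold sitesToGo
    rw [hk, h2]
    congr 1
    push_cast
    ring

lemma hasDerivAt_det_hopMatrix {N : ℕ} (a : ℤ) {x : Fin N → ℤ} (hx : StrictMono x) {t : ℝ}
    (ht : 0 < t) :
    HasDerivAt (fun s => (hopMatrix (sitesToGo a x) s).det)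
      (∑ j : Fin N, if ∀ k, x k ≠ x j + 1 then
        (hopMatrix (sitesToGo a (Function.update x j (x j + 1))) t).det -
          (hopMatrix (sitesToGo a x) t).det else 0) t := by
  have h := hasDerivAt_det (A := hopMatrix (sitesToGo a x))
    (A' := Matrix.of fun j i : Fin N => rowEntry (j + 1) i (sitesToGo a x j) t)
    (fun j i => hasDerivAt_rowEntry j i _ ht)
  refine h.congr_deriv (Finset.sum_congr rfl fun j _ => ?_)
  exact det_updateRow_sitesToGo a hx ht.le j

lemma continuousOn_det_hopMatrix {N : ℕ} (κ : Fin N → ℤ) :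
    ContinuousOn (fun t => (hopMatrix κ t).det) (Set.Ici 0) := by
  refine (continuous_id.matrix_det).comp_continuousOn ?_
  exact continuousOn_pi.2 fun j => continuousOn_pi.2 fun i => continuousOn_rowEntry j i (κ j)

lemma exists_norm_det_hopMatrix_le (N : ℕ) {T : ℝ} (hT : 0 ≤ T) :
    ∃ C, ∀ κ : Fin N → ℤ, (∀ j, 0 ≤ κ j) → ∀ t ∈ Set.Icc 0 T, ‖(hopMatrix κ t).det‖ ≤ C := by
  choose B hB using fun j i : Fin N => exists_norm_rowEntry_le j i hT
  refine ⟨_, fun κ hκ t ht => Matrix.det_le (abv := NormedField.toAbsoluteValue ℂ)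
    (x := ∑ j : Fin N, ∑ i : Fin N, |B j i|) fun j i => ?_⟩
  calc ‖rowEntry j i (κ j) t‖ ≤ |B j i| := (hB j i _ (hκ j) t ht).trans (le_abs_self _)
    _ ≤ ∑ i : Fin N, |B j i| :=
      Finset.single_le_sum (f := fun i => |B j i|) (fun _ _ => abs_nonneg _) (Finset.mem_univ i)
    _ ≤ ∑ j : Fin N, ∑ i : Fin N, |B j i| :=
      Finset.single_le_sum (f := fun j => ∑ i : Fin N, |B j i|)
        (fun _ _ => Finset.sum_nonneg fun _ _ => abs_nonneg _) (Finset.mem_univ j)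

/-- If the leftmost particle has reached `a`, all arguments are zero and the matrix is unipotent
upper triangular; otherwise the top row vanishes. -/
lemma det_hopMatrix_zero_right {N : ℕ} [NeZero N] (a : ℤ) {x : Fin N → ℤ} (hx : StrictMono x) :
    (hopMatrix (sitesToGo a x) 0).det = if a ≤ x 0 then 1 else 0 := by
  split_ifs with h
  · have hκ : ∀ j, sitesToGo a x j = 0 := by
      intro j
      have := hx.add_val_sub_le (Fin.zero_le j)
      refine max_eq_right ?_
      simp at this
      linarith
    rw [Matrix.det_of_isUpperTriangular]
    · exact Finset.prod_eq_one fun j _ => rowEntry_self_of_nonpos j (hκ j).le le_rfl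
    · intro j i hij
      exact rowEntry_of_lt_of_nonpos hij (hκ j).le le_rfl
  · refine Matrix.det_eq_zero_of_row_eq_zero 0 fun i => ?_
    have : 0 < sitesToGo a x 0 := lt_max_of_lt_left (by simp; omega)
    simpa [hopMatrix] using rowEntry_zero_left_zero_right i this

/-- Rows with nonpositive arguments do not influence the determinant. -/
lemma det_hopMatrix_max_zero {N : ℕ} {κ : Fin N → ℤ} (hκ : Antitone κ) {t : ℝ} (ht : 0 ≤ t) :
    (hopMatrix (fun j => max (κ j) 0) t).det = (hopMatrix κ t).det := by
  -- Since `κ` is antitone, the rows with nonpositive argument come last; the matrix is block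
  -- triangular, and their block is unipotent. The remaining block is untouched by the cutoff.
  have htri : ∀ κ' : Fin N → ℤ, (∀ j, κ j ≤ 0 → κ' j ≤ 0) → (hopMatrix κ' t).det =
      ((hopMatrix κ' t).toSquareBlockProp fun j => 0 < κ j).det := by
    intro κ' hκ'
    rw [Matrix.twoBlockTriangular_det _ fun j => 0 < κ j]
    · rw [Matrix.det_of_isUpperTriangular (M := (hopMatrix κ' t).toSquareBlockProp
        fun j => ¬ 0 < κ j), Finset.prod_eq_one, mul_one]
      · rintro ⟨j, hj⟩ _
        exact rowEntry_self_of_nonpos j (hκ' j (not_lt.1 hj)) ht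
      · rintro ⟨j, hj⟩ ⟨i, hi⟩ hij
        exact rowEntry_of_lt_of_nonpos hij (hκ' j (not_lt.1 hj)) ht
    · intro j hj i hi
      refine rowEntry_of_lt_of_nonpos ?_ (hκ' j (not_lt.1 hj)) ht
      by_contra hlt
      have := hκ (Fin.le_def.2 (not_lt.1 hlt))
      omega
  rw [htri _ fun j hj => (max_eq_right hj).le, htri κ fun j hj => hj]
  congr 1
  ext ⟨j, hj⟩ i
  simp [Matrix.toSquareBlockProp, hopMatrix, max_eq_left hj.le]

lemma det_hopMatrix_sitesToGo {N : ℕ} [NeZero N] {y : Fin N → ℤ} (hy : StrictMono y) (M : ℤ)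
    {t : ℝ} (ht : 0 ≤ t) : (hopMatrix (sitesToGo (y 0 + M) y) t).det =
      (Matrix.of fun j i : Fin N => tailEntry j i ((M : ℂ) + y 0 - y j) t).det := by
  have hanti : Antitone fun j : Fin N => y 0 + M - y j + (j : ℤ) := by
    intro i j hij
    have := hy.add_val_sub_le hij
    simp only
    linarith
  rw [show sitesToGo (y 0 + M) y = fun j : Fin N => max (y 0 + M - y j + (j : ℤ)) 0 from rfl,
    det_hopMatrix_max_zero hanti ht]
  congr 1
  ext j i
  simp only [hopMatrix, Matrix.of_apply, rowEntry]
  congr 1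
  push_cast
  ring

/-- Uniqueness for the backward equation is applied to the real part, with the indicator as initial
datum, and to the imaginary part, with initial datum zero. -/
lemma IsTASEP.measureReal_eq_det {Ω : Type*} {mΩ : MeasurableSpace Ω} {μ : Measure Ω}
    [IsProbabilityMeasure μ] {ℱ : Filtration ℝ≥0 mΩ} {N : ℕ} [NeZero N] {y : Fin N → ℤ}
    {X : ℝ≥0 → Ω → Fin N → ℤ} (hX : IsTASEP μ ℱ y X) (hy : StrictMono y) (T : ℝ≥0) (a : ℤ) :
    ((μ.real {ω | a ≤ X T ω 0} : ℝ) : ℂ) = (hopMatrix (sitesToGo a y) T).det := by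
  obtain ⟨C, hC⟩ := exists_norm_det_hopMatrix_le N T.2
  have hC' : ∀ t ∈ Set.Icc (0 : ℝ) T, ∀ x : Fin N → ℤ, ‖(hopMatrix (sitesToGo a x) t).det‖ ≤ C :=
    fun t ht x => hC _ (fun j => le_max_right _ _) t ht
  have hc : ∀ x : Fin N → ℤ, ContinuousOn (fun t => (hopMatrix (sitesToGo a x) t).det)
      (Set.Icc (0 : ℝ) T) := fun x =>
    (continuousOn_det_hopMatrix _).mono Set.Icc_subset_Ici_self
  have hre : ∫ ω, (if a ≤ X T ω 0 then (1 : ℝ) else 0) ∂μ =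
      (hopMatrix (sitesToGo a y) T).det.re := by
    refine hX.integral_eq_of_backward hy (f := fun x => if a ≤ x 0 then (1 : ℝ) else 0)
      (u := fun t x => (hopMatrix (sitesToGo a x) t).det.re) (B := 1) (C := C) ?_ ?_ ?_ ?_ ?_
    · intro x
      split_ifs <;> simp
    · intro x hx
      rw [det_hopMatrix_zero_right a hx]
      split_ifs <;> simp
    · exact fun t ht x _ => (Complex.abs_re_le_norm _).trans (hC' t ht x)
    · exact fun x _ => Complex.continuous_re.comp_continuousOn (hc x)
    · intro x hx t ht
      refine ((Complex.reCLM.hasFDerivAt).comp_hasDerivAt t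
        (hasDerivAt_det_hopMatrix a hx ht.1)).congr_deriv ?_
      rw [map_sum, tasepGenerator]
      refine Finset.sum_congr rfl fun j _ => ?_
      split_ifs <;> simp
  have him : ∫ _, (0 : ℝ) ∂μ = (hopMatrix (sitesToGo a y) T).det.im := by
    refine hX.integral_eq_of_backward hy (f := fun _ => (0 : ℝ))
      (u := fun t x => (hopMatrix (sitesToGo a x) t).det.im) (B := 0) (C := C) ?_ ?_ ?_ ?_ ?_
    · simp
    · intro x hx
      rw [det_hopMatrix_zero_right a hx]
      split_ifs <;> simp
    · exact fun t ht x _ => (Complex.abs_im_le_norm _).trans (hC' t ht x)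
    · exact fun x _ => Complex.continuous_im.comp_continuousOn (hc x)
    · intro x hx t ht
      refine ((Complex.imCLM.hasFDerivAt).comp_hasDerivAt t
        (hasDerivAt_det_hopMatrix a hx ht.1)).congr_deriv ?_
      rw [map_sum, tasepGenerator]
      refine Finset.sum_congr rfl fun j _ => ?_
      split_ifs <;> simp
  have hset : MeasurableSet {ω | a ≤ X T ω 0} :=
    (hX.measurable T) (Set.to_countable {x : Fin N → ℤ | a ≤ x 0}).measurableSet
  have hprob : ∫ ω, (if a ≤ X T ω 0 then (1 : ℝ) else 0) ∂μ = μ.real {ω | a ≤ X T ω 0} := by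
    rw [← integral_indicator_one hset]
    refine integral_congr_ae (ae_of_all _ fun ω => ?_)
    simp [Set.indicator_apply]
  rw [hprob] at hre
  rw [integral_zero] at him
  exact Complex.ext (by simpa using hre) (by simpa using him)

end

/-- The law of the leftmost particle of the exclusion process started from `y 0 < y 1 < ⋯`.
The rightmost initial position is `y (Fin.rev 0)`. -/
theorem theorem4 {Ω : Type*} {mΩ : MeasurableSpace Ω} (μ : Measure Ω) [IsProbabilityMeasure μ]
    (ℱ : Filtration ℝ≥0 mΩ) {N : ℕ} [NeZero N] (y : Fin N → ℤ) (hy : StrictMono y)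
    (X : ℝ≥0 → Ω → Fin N → ℤ) (hX : IsTASEP μ ℱ y X) (T : ℝ≥0) :
    -- the integral converges absolutely for every complex `M` with `Re M > y_N - y_1`
    (∀ M : ℂ, ((y (Fin.rev 0) - y 0 : ℤ) : ℝ) < M.re →
      IntegrableOn (hopIntegrand y M) (Set.Icc (0 : Fin N → ℝ) (fun _ => (T : ℝ)))) ∧
    -- the formula for integers `M > y_N - y_1`
    (∀ M : ℤ, y (Fin.rev 0) - y 0 < M →
      ((μ.real {ω | y 0 + M ≤ X T ω 0} : ℝ) : ℂ) = hopIntegral y T M) ∧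
    -- the analytic continuation in `M` exists on all of `ℂ`, and it gives the probability at
    -- every integer `M`
    (0 < T → ∃ g : ℂ → ℂ, Differentiable ℂ g ∧
      (∀ M : ℂ, ((y (Fin.rev 0) - y 0 : ℤ) : ℝ) < M.re → g M = hopIntegral y T M) ∧
      ∀ M : ℤ, ((μ.real {ω | y 0 + M ≤ X T ω 0} : ℝ) : ℂ) = g M) ∧
    -- the step initial condition `y_j = -N + j`
    ((∀ j : Fin N, y j = -(N : ℤ) + ((j : ℤ) + 1)) →
      ∀ M : ℕ, N ≤ M → hopIntegral y T (M : ℂ) = (laguerreIntegral N M T : ℂ)) := by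
  have hT : (0 : ℝ) ≤ T := T.2
  have hdet : ∀ M : ℤ, ((μ.real {ω | y 0 + M ≤ X T ω 0} : ℝ) : ℂ) =
      (Matrix.of fun j i : Fin N => tailEntry j i ((M : ℂ) + y 0 - y j) T).det := fun M => by
    rw [hX.measureReal_eq_det hy T, det_hopMatrix_sitesToGo hy M hT]
  refine ⟨fun M hM => integrableOn_hopIntegrand hy hM hT, fun M hM => ?_, fun hT0 => ?_,
    fun hstep M hM => hopIntegral_step hstep hM T⟩
  · rw [hdet, hopIntegral_eq_det hy (by rw [Complex.intCast_re]; exact_mod_cast hM) hT]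
  -- The determinant itself is the continuation: it is entire in `M`, and at every integer it is the
  -- probability.
  · refine ⟨fun M => (Matrix.of fun j i : Fin N => tailEntry j i (M + y 0 - y j) T).det, ?_,
      fun M hM => (hopIntegral_eq_det hy hM hT).symm, hdet⟩
    simp_rw [Matrix.det_apply', Matrix.of_apply]
    refine Differentiable.fun_sum fun σ _ => (differentiable_const _).mul ?_
    refine Differentiable.fun_finsetProd fun j _ => ?_
    exact (differentiable_tailEntry _ _ (NNReal.coe_pos.2 hT0)).comp
      ((differentiable_id.add (differentiable_const _)).sub (differentiable_const _))
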